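/- **Theorem** ($\mathrm{permAs}_\infty$ is a dg quasi-free permutad). Let $K$ be a commutative ring and write $\underline n=\{1,\dots,n\}$. For a surjective map $t:\underline n\to\underline k$, a vertex $v\in\underline k$ has arity $|v|=\#t^{-1}(v)+1$. Given surjections $s_j:\underline{\#t^{-1}(j)}\to\underline{m_j}$, the substitution $(t;s_1,\dots,s_k):\underline n\to\underline{m_1+\cdots+m_k}$ sends the $b$-th element of $t^{-1}(j)$ to $m_1+\cdots+m_{j-1}+s_j(b)$. A *graded permutad* over $K$ is a family of $\mathbb Z$-graded $K$-modules $(\mathcal P_n)_{n\ge1}$ with, for each surjection $t:\underline n\to\underline k$ (including the empty map $\underline 0\to\underline 0$), a degree-preserving $K$-multilinear composition $\Gamma(t;-):\prod_{v}\mathcal P_{|v|}\to\mathcal P_{n+1}$, compatible with substitution, such that $\Gamma(t;\mu)=\mu$ if $k=1$, and such that $\mathcal P_1=K\,\mathrm{id}$ is free of rank one on $\mathrm{id}=\Gamma(\underline0\to\underline0)$. A *derivation* is a family of $K$-linear maps $d:\mathcal P_n\to\mathcal P_n$ of degree $-1$ with $$d\,\Gamma(t;\mu_1,\dots,\mu_k)=\sum_{i=1}^k(-1)^{|\mu_1|+\cdots+|\mu_{i-1}|}\,\Gamma(t;\mu_1,\dots,d\mu_i,\dots,\mu_k)$$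 for homogeneous $\mu_i$ of degree $|\mu_i|$. The pair $(\mathcal P,d)$ is a *dg permutad* if moreover $d^2=0$; it is *quasi-free* if the underlying graded permutad $\mathcal P$ is free. Let $\mathrm{permAs}_\infty$ be the graded permutad for which $(\mathrm{permAs}_\infty)_{n+1}$ is the free $K$-module on all surjections $t:\underline n\to\underline k$, $k\geq 0$, with $t$ in degree $n-k$, and whose compositions are the multilinear extension of substitution. For $n\ge2$ let $m_n$ be the unique surjection $\underline{n-1}\to\underline1$, which has arity $n$ and degree $n-2$. Then: 1. $\mathrm{permAs}_\infty$ is the free graded permutad on the generators $m_n$, $n\ge 2$. 2. There is a unique derivation $d$ of $\mathrm{permAs}_\infty$ which on each generator $m_n$ is the boundary of the big cell of the permutohedron, that is, $$d(m_n)=\sum_{t}\mathrm{sgn}(\sigma_t)\,(-1)^{\#t^{-1}(1)}\,t ,$$ where the sum is over all surjections $t:\underline{n-1}\to\underline2$ and $\sigma_t$ is the permutation that lists the elements of $t^{-1}(1)$ in increasing order followed by those of $t^{-1}(2)$ in increasing order. It satisfies $d^2=0$. Hence $(\mathrm{permAs}_\infty,d)$ is a dg quasi-free permutad. 3. For each $n\ge2$,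 let $\mathtt P^{n-2}\subset\mathbb R^{n-1}$ be the permutohedron, the convex hull of the points $M(\sigma)=(\sigma(1),\dots,\sigma(n-1))$, $\sigma\in\mathbb S_{n-1}$, with its faces as cells. For every choice of orientations of its positive-dimensional faces (vertices being positively oriented), let $C_\bullet(\mathtt P^{n-2})$ be its cellular chain complex over $K$, that is, the free module on the nonempty faces, graded by dimension, with $\partial F=\sum_G[F:G]\,G$, where $G$ runs over the facets of $F$ and $[F:G]=\pm1$ compares the orientation of $F$ with an outward vector followed by the orientation of $G$. Then $\partial^2=0$, and there is an isomorphism of chain complexes $$\big((\mathrm{permAs}_\infty)_n,d\big)\;\cong\; C_\bullet(\mathtt P^{n-2})$$ which sends each surjection $t$ to $\pm$ the face that is the convex hull of those $M(\sigma)$ for which $\sigma(i)<\sigma(j)$ whenever $t(i)<t(j)$. In particular $m_n$ is sent to $\pm$ the big cell. -/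

import Mathlib

universe u v w x

noncomputable section

/-- A surjective map `{1,…,n} → {1,…,size}` (with `Fin n` in place of `{1,…,n}`); the elements of
the target are called the vertices. -/
structure Surj (n : ℕ) where
  size : ℕ
  toFun : Fin n → Fin size
  surjective : Function.Surjective toFun

namespace Surj

variable {n : ℕ}

/-- `a v` is the number of inputs of the vertex `v`, i.e. the cardinality of the fibre over `v`
(the arity of the vertex `v` is `a v + 1`). The function `a` is determined by `t`; it is carried
along as a separate variable in order to avoid transport along equalities of natural numbers. -/
def HasType (t : Surj n) (a : Fin t.size → ℕ) : Prop :=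
  ∀ v, (Finset.univ.filter fun i => t.toFun i = v).card = a v

theorem size_le (t : Surj n) : t.size ≤ n := by
  simpa using Fintype.card_le_of_surjective _ t.surjective

instance : Finite (Surj n) := by
  refine Finite.of_injective (β := Σ k : Fin (n + 1), (Fin n → Fin k))
    (fun t => ⟨⟨t.size, Nat.lt_succ_of_le t.size_le⟩, t.toFun⟩) ?_
  rintro ⟨k, f, hf⟩ ⟨l, g, hg⟩ h
  simp only [Sigma.mk.injEq, Fin.mk.injEq] at h
  obtain ⟨rfl, h⟩ := h
  simpa using h

instance : Fintype (Surj n) := Fintype.ofFinite _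

instance : DecidableEq (Surj n) := Classical.decEq _

/-- The corolla: the surjective map with exactly one vertex, and `n + 1` inputs. -/
def corolla (n : ℕ) : Surj (n + 1) where
  size := 1
  toFun := fun _ => 0
  surjective := fun v => ⟨0, (Subsingleton.elim v 0).symm⟩

/-- The unique map from the empty set to the empty set, with no vertex. -/
def empty : Surj 0 where
  size := 0
  toFun := Fin.elim0
  surjective := fun v => v.elim0

theorem corolla_hasType (n : ℕ) : (corolla n).HasType fun _ => n + 1 := by
  intro v
  have hv : ∀ i, (corolla n).toFun i = v := fun i => Subsingleton.elim (α := Fin 1) _ v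
  simp [hv]

theorem empty_hasType (a : Fin empty.size → ℕ) : empty.HasType a := fun v => Fin.elim0 v

/-- The position (counted from `0`) of `i` in the fibre of `t` that contains it. -/
def pos (t : Surj n) (i : Fin n) : ℕ :=
  (Finset.univ.filter fun j => t.toFun j = t.toFun i ∧ j < i).card

theorem pos_lt_pos (t : Surj n) {i j : Fin n} (h : t.toFun i = t.toFun j) (hij : i < j) :
    t.pos i < t.pos j := by
  apply Finset.card_lt_card
  rw [Finset.ssubset_iff_of_subset]
  · exact ⟨i, by simp [h, hij], by simp⟩
  · intro l hl
    simp only [Finset.mem_filter, Finset.mem_univ, true_and] at hl ⊢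
    exact ⟨hl.1.trans h, hl.2.trans hij⟩

theorem pos_lt_pos_iff (t : Surj n) {i j : Fin n} (h : t.toFun i = t.toFun j) :
    t.pos i < t.pos j ↔ i < j := by
  refine ⟨fun hp => ?_, t.pos_lt_pos h⟩
  by_contra hij
  rcases eq_or_lt_of_le (not_lt.1 hij) with rfl | h'
  · exact lt_irrefl _ hp
  · exact lt_asymm hp (t.pos_lt_pos h.symm h')

theorem pos_lt (t : Surj n) {a : Fin t.size → ℕ} (h : t.HasType a) (i : Fin n) :
    t.pos i < a (t.toFun i) := by
  rw [← h]
  apply Finset.card_lt_card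
  rw [Finset.ssubset_iff_of_subset]
  · exact ⟨i, by simp, by simp⟩
  · intro l hl
    simp only [Finset.mem_filter, Finset.mem_univ, true_and] at hl ⊢
    exact hl.1

theorem sum_type (t : Surj n) {a : Fin t.size → ℕ} (h : t.HasType a) : ∑ v, a v = n := by
  simp_rw [← h _]
  rw [← Finset.card_eq_sum_card_fiberwise (f := t.toFun) (by intro x _; simp)]
  simp

/-- The input `i` as the `b`-th element of the fibre over the vertex `v`. -/
def locate (t : Surj n) {a : Fin t.size → ℕ} (h : t.HasType a) (i : Fin n) :
    Σ v : Fin t.size, Fin (a v) :=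
  ⟨t.toFun i, ⟨t.pos i, t.pos_lt h i⟩⟩

theorem locate_bijective (t : Surj n) {a : Fin t.size → ℕ} (h : t.HasType a) :
    Function.Bijective (t.locate h) := by
  rw [Fintype.bijective_iff_injective_and_card]
  refine ⟨fun i j hij => ?_, by simp [t.sum_type h]⟩
  have h1 : t.toFun i = t.toFun j := congrArg Sigma.fst hij
  have h2 : t.pos i = t.pos j :=
    congrArg (fun p : Σ v : Fin t.size, Fin (a v) => (p.2 : ℕ)) hij
  rcases lt_trichotomy i j with hlt | rfl | hlt
  · exact absurd h2 (t.pos_lt_pos h1 hlt).ne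
  · rfl
  · exact absurd h2 (t.pos_lt_pos h1.symm hlt).ne'

/-- The substitution `(t; s₁, …, s_k)`: an input `i` which is the `b`-th element of the fibre of
`t` over `j` is sent to `m₁ + ⋯ + m_{j-1} + s_j(b)`, where `m_j` is the number of vertices
of `s_j`. (The bijection `finSigmaFinEquiv` sends `⟨j, v⟩` to `m₁ + ⋯ + m_{j-1} + v`.) -/
def subst (t : Surj n) (a : Fin t.size → ℕ) (h : t.HasType a) (s : ∀ j, Surj (a j)) : Surj n where
  size := ∑ j, (s j).size
  toFun := fun i =>
    finSigmaFinEquiv ⟨t.toFun i, (s (t.toFun i)).toFun ⟨t.pos i, t.pos_lt h i⟩⟩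
  surjective := by
    intro w
    obtain ⟨⟨j, v⟩, rfl⟩ := finSigmaFinEquiv.surjective w
    obtain ⟨b, rfl⟩ := (s j).surjective v
    obtain ⟨i, hi⟩ := (t.locate_bijective h).2 ⟨j, b⟩
    refine ⟨i, ?_⟩
    exact congrArg (fun p : Σ v : Fin t.size, Fin (a v) =>
      finSigmaFinEquiv (⟨p.1, (s p.1).toFun p.2⟩ : Σ j, Fin (s j).size)) hi

/-- The vertices of a substitution: `m₁ + ⋯ + m_{j-1} + v` corresponds to the vertex `v`
of `s_j`. -/
def substVertex (t : Surj n) (a : Fin t.size → ℕ) (h : t.HasType a) (s : ∀ j, Surj (a j)) :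
    Fin (t.subst a h s).size ≃ Σ j, Fin (s j).size :=
  finSigmaFinEquiv.symm

theorem substVertex_toFun (t : Surj n) (a : Fin t.size → ℕ) (h : t.HasType a)
    (s : ∀ j, Surj (a j)) (i : Fin n) :
    t.substVertex a h s ((t.subst a h s).toFun i) =
      ⟨t.toFun i, (s (t.toFun i)).toFun ⟨t.pos i, t.pos_lt h i⟩⟩ :=
  finSigmaFinEquiv.symm_apply_apply _

/-- The type of a substitution whose pieces `s_j` have type `b_j`. -/
abbrev substType (t : Surj n) (a : Fin t.size → ℕ) (h : t.HasType a) (s : ∀ j, Surj (a j))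
    (b : ∀ j, Fin (s j).size → ℕ) : Fin (t.subst a h s).size → ℕ :=
  fun w => b (t.substVertex a h s w).1 (t.substVertex a h s w).2

theorem subst_hasType (t : Surj n) (a : Fin t.size → ℕ) (h : t.HasType a) (s : ∀ j, Surj (a j))
    (b : ∀ j, Fin (s j).size → ℕ) (hs : ∀ j, (s j).HasType (b j)) :
    (t.subst a h s).HasType (t.substType a h s b) := by
  intro w
  obtain ⟨⟨j, v⟩, rfl⟩ := (t.substVertex a h s).symm.surjective w
  have e : ∀ i, (t.subst a h s).toFun i = (t.substVertex a h s).symm ⟨j, v⟩ ↔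
      (⟨t.toFun i, (s (t.toFun i)).toFun ⟨t.pos i, t.pos_lt h i⟩⟩ :
        Σ j, Fin (s j).size) = ⟨j, v⟩ := by
    intro i
    rw [Equiv.eq_symm_apply, substVertex_toFun]
  have e' : ∀ p : Σ j, Fin (s j).size, p = ⟨j, v⟩ → b p.1 p.2 = b j v := by
    rintro _ rfl
    rfl
  simp only [e]
  refine Eq.trans ?_ (e' _ ((t.substVertex a h s).apply_symm_apply _)).symm
  rw [← hs j v]
  symm
  refine Finset.card_bij
    (fun c _ => (Equiv.ofBijective _ (t.locate_bijective h)).symm ⟨j, c⟩) ?_ ?_ ?_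
  · intro c hc
    simp only [Finset.mem_filter, Finset.mem_univ, true_and] at hc ⊢
    subst hc
    have hi := (Equiv.ofBijective _ (t.locate_bijective h)).apply_symm_apply ⟨j, c⟩
    exact congrArg (fun p : Σ v : Fin t.size, Fin (a v) =>
      (⟨p.1, (s p.1).toFun p.2⟩ : Σ j, Fin (s j).size)) hi
  · intro c _ c' _ hcc
    simpa using hcc
  · intro i hi
    simp only [Finset.mem_filter, Finset.mem_univ, true_and] at hi
    have h1 : t.toFun i = j := congrArg Sigma.fst hi
    subst h1
    refine ⟨⟨t.pos i, t.pos_lt h i⟩, ?_, ?_⟩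
    · simpa using hi
    · rw [Equiv.symm_apply_eq]
      rfl

theorem finSigma_lt {m : ℕ} {f : Fin m → ℕ} {x y : Σ j, Fin (f j)} (hxy : x.1 < y.1) :
    finSigmaFinEquiv x < finSigmaFinEquiv y := by
  obtain ⟨j, v⟩ := x
  obtain ⟨j', v'⟩ := y
  simp only at hxy
  rw [Fin.lt_def, finSigmaFinEquiv_apply, finSigmaFinEquiv_apply]
  simp only
  have e : ∀ (q : ℕ) (hq : q ≤ m), ∑ i : Fin q, f (Fin.castLE hq i) =
      ∑ i ∈ Finset.range q, if hi : i < m then f ⟨i, hi⟩ else 0 := by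
    intro q hq
    rw [Finset.sum_range]
    refine Finset.sum_congr rfl fun i _ => ?_
    rw [dif_pos (i.2.trans_le hq)]
    rfl
  rw [e _ j.2.le, e _ j'.2.le]
  have h1 : (∑ i ∈ Finset.range (j : ℕ), if hi : i < m then f ⟨i, hi⟩ else 0) + f j ≤
      ∑ i ∈ Finset.range (j' : ℕ), if hi : i < m then f ⟨i, hi⟩ else 0 := by
    have : f j = if hi : (j : ℕ) < m then f ⟨j, hi⟩ else 0 := by simp
    rw [this, ← Finset.sum_range_succ]
    exact Finset.sum_le_sum_of_subset (Finset.range_mono hxy)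
  have := v.2
  omega

theorem finSigma_lt_iff {m : ℕ} {f : Fin m → ℕ} (x y : Σ j, Fin (f j)) :
    finSigmaFinEquiv x < finSigmaFinEquiv y ↔
      x.1 < y.1 ∨ x.1 = y.1 ∧ (x.2 : ℕ) < (y.2 : ℕ) := by
  rcases lt_trichotomy x.1 y.1 with h | h | h
  · simp [h, finSigma_lt h]
  · obtain ⟨j, v⟩ := x
    obtain ⟨j', v'⟩ := y
    simp only at h
    subst h
    rw [Fin.lt_def, finSigmaFinEquiv_apply, finSigmaFinEquiv_apply]
    simp
  · simp [h.not_gt, h.ne', (finSigma_lt h).not_gt]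

/-- A surjective map is determined by the order relation it induces on the inputs. -/
theorem ext_of_lt_iff {s t : Surj n}
    (h : ∀ i j, s.toFun i < s.toFun j ↔ t.toFun i < t.toFun j) : s = t := by
  obtain ⟨k, f, hf⟩ := s
  obtain ⟨l, g, hg⟩ := t
  simp only at h
  have heq : ∀ i j, f i = f j ↔ g i = g j := by
    intro i j
    rw [le_antisymm_iff, le_antisymm_iff, ← not_lt, ← not_lt, ← not_lt, ← not_lt, h, h]
  let e : Fin k → Fin l := fun v => g (hf v).choose
  have he : ∀ i, e (f i) = g i := fun i => (heq _ _).1 (hf (f i)).choose_spec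
  have hmono : StrictMono e := by
    intro v w hvw
    obtain ⟨i, rfl⟩ := hf v
    obtain ⟨j, rfl⟩ := hf w
    rw [he, he]
    exact (h i j).1 hvw
  have hsurj : Function.Surjective e := by
    intro w
    obtain ⟨i, rfl⟩ := hg w
    exact ⟨f i, he i⟩
  have hkl : k = l := by
    simpa using Fintype.card_of_bijective ⟨hmono.injective, hsurj⟩
  subst hkl
  have hid : e = id := by
    have := Subsingleton.elim (hmono.orderIsoOfSurjective e hsurj) (OrderIso.refl _)
    funext v
    exact congrArg (fun o : Fin k ≃o Fin k => o v) this
  have : f = g := by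
    funext i
    rw [← he, hid]
    rfl
  subst this
  rfl

theorem subst_lt_iff (t : Surj n) (a : Fin t.size → ℕ) (h : t.HasType a) (s : ∀ j, Surj (a j))
    (i j : Fin n) :
    (t.subst a h s).toFun i < (t.subst a h s).toFun j ↔ t.toFun i < t.toFun j ∨
      t.toFun i = t.toFun j ∧
        ((s (t.toFun i)).toFun ⟨t.pos i, t.pos_lt h i⟩ : ℕ) <
          ((s (t.toFun j)).toFun ⟨t.pos j, t.pos_lt h j⟩ : ℕ) :=
  finSigma_lt_iff _ _

theorem subst_eq_iff (t : Surj n) (a : Fin t.size → ℕ) (h : t.HasType a) (s : ∀ j, Surj (a j))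
    (i j : Fin n) :
    (t.subst a h s).toFun i = (t.subst a h s).toFun j ↔ 
      t.toFun i = t.toFun j ∧
        ((s (t.toFun i)).toFun ⟨t.pos i, t.pos_lt h i⟩ : ℕ) =
          ((s (t.toFun j)).toFun ⟨t.pos j, t.pos_lt h j⟩ : ℕ) := by
  rw [le_antisymm_iff, ← not_lt, ← not_lt, subst_lt_iff, subst_lt_iff]
  constructor
  · rintro ⟨h1, h2⟩
    push Not at h1 h2
    have h3 := le_antisymm h1.1 h2.1
    exact ⟨h3, le_antisymm (h1.2 h3.symm) (h2.2 h3)⟩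
  · rintro ⟨h1, h2⟩
    simp [h1, h2]

theorem subst_pos (t : Surj n) (a : Fin t.size → ℕ) (h : t.HasType a) (s : ∀ j, Surj (a j))
    (i : Fin n) :
    (t.subst a h s).pos i = (s (t.toFun i)).pos ⟨t.pos i, t.pos_lt h i⟩ := by
  symm
  refine Finset.card_bij (fun c _ =>
    (Equiv.ofBijective _ (t.locate_bijective h)).symm ⟨t.toFun i, c⟩) ?_ ?_ ?_
  · intro c hc
    simp only [Finset.mem_filter, Finset.mem_univ, true_and] at hc ⊢
    generalize hl : (Equiv.ofBijective _ (t.locate_bijective h)).symm ⟨t.toFun i, c⟩ = l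
    have hl' : t.locate h l = ⟨t.toFun i, c⟩ := by
      rw [← hl]
      exact (Equiv.ofBijective _ (t.locate_bijective h)).apply_symm_apply _
    have h1 : t.toFun l = t.toFun i := congrArg Sigma.fst hl'
    have h2 : t.pos l = c :=
      congrArg (fun p : Σ v : Fin t.size, Fin (a v) => (p.2 : ℕ)) hl'
    refine ⟨(subst_eq_iff t a h s l i).2 ⟨h1, ?_⟩, ?_⟩
    · have hc1 := congrArg Fin.val hc.1
      refine Eq.trans ?_ hc1
      exact congrArg (fun p : Σ v : Fin t.size, Fin (a v) => ((s p.1).toFun p.2 : ℕ)) hl'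
    · rw [← t.pos_lt_pos_iff h1, h2]
      exact hc.2
  · intro c _ c' _ hcc
    simpa using hcc
  · intro l hl
    simp only [Finset.mem_filter, Finset.mem_univ, true_and] at hl
    obtain ⟨h1, h2⟩ := (subst_eq_iff t a h s l i).1 hl.1
    have hlt := (t.pos_lt_pos_iff h1).2 hl.2
    have key : ∀ (v : Fin t.size) (hv : t.toFun l = v) (x : Fin (a v)),
        ((s (t.toFun l)).toFun ⟨t.pos l, t.pos_lt h l⟩ : ℕ) = ((s v).toFun x : ℕ) →
        t.pos l < x →
        ∃ c, ∃ (_ : c ∈ Finset.univ.filter fun j => (s v).toFun j = (s v).toFun x ∧ j < x),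
          (Equiv.ofBijective _ (t.locate_bijective h)).symm ⟨v, c⟩ = l := by
      intro v hv x hx hlx
      subst hv
      refine ⟨⟨t.pos l, t.pos_lt h l⟩, ?_, ?_⟩
      · simp only [Finset.mem_filter, Finset.mem_univ, true_and]
        exact ⟨Fin.ext hx, hlx⟩
      · rw [Equiv.symm_apply_eq]
        rfl
    exact key _ h1 _ h2 hlt

/-- Substitution is associative. -/
theorem subst_subst (t : Surj n) (a : Fin t.size → ℕ) (h : t.HasType a) (s : ∀ j, Surj (a j))
    (b : ∀ j, Fin (s j).size → ℕ) (hs : ∀ j, (s j).HasType (b j))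
    (r : ∀ j v, Surj (b j v)) :
    (t.subst a h s).subst (t.substType a h s b) (t.subst_hasType a h s b hs)
        (fun w => r (t.substVertex a h s w).1 (t.substVertex a h s w).2) =
      t.subst a h (fun j => (s j).subst (b j) (hs j) (r j)) := by
  have key : ∀ (i : Fin n) (w : Σ j, Fin (s j).size) (x : Fin (b w.1 w.2)),
      w = ⟨t.toFun i, (s (t.toFun i)).toFun ⟨t.pos i, t.pos_lt h i⟩⟩ →
      (x : ℕ) = (s (t.toFun i)).pos ⟨t.pos i, t.pos_lt h i⟩ →
      ((r w.1 w.2).toFun x : ℕ) =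
        ((r (t.toFun i) ((s (t.toFun i)).toFun ⟨t.pos i, t.pos_lt h i⟩)).toFun
          ⟨(s (t.toFun i)).pos ⟨t.pos i, t.pos_lt h i⟩, (s (t.toFun i)).pos_lt (hs _) _⟩ : ℕ) := by
    intro i w x hw hx
    subst hw
    congr 2
    exact Fin.ext hx
  apply ext_of_lt_iff
  intro i j
  rw [subst_lt_iff, subst_lt_iff, subst_lt_iff, subst_eq_iff,
    key i (t.substVertex a h s ((t.subst a h s).toFun i)) _
      (substVertex_toFun _ _ _ _ _) (subst_pos t a h s i),
    key j (t.substVertex a h s ((t.subst a h s).toFun j)) _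
      (substVertex_toFun _ _ _ _ _) (subst_pos t a h s j)]
  have key2 : ∀ (v : Fin t.size) (hv : t.toFun i = v) (x : Fin (a v)),
      (((s (t.toFun i)).subst (b (t.toFun i)) (hs _) (r _)).toFun
          ⟨t.pos i, t.pos_lt h i⟩ : ℕ) <
        (((s v).subst (b v) (hs _) (r _)).toFun x : ℕ) ↔
      ((s (t.toFun i)).toFun ⟨t.pos i, t.pos_lt h i⟩ : ℕ) < ((s v).toFun x : ℕ) ∨
      ((s (t.toFun i)).toFun ⟨t.pos i, t.pos_lt h i⟩ : ℕ) = ((s v).toFun x : ℕ) ∧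
      ((r (t.toFun i) ((s (t.toFun i)).toFun ⟨t.pos i, t.pos_lt h i⟩)).toFun
          ⟨(s (t.toFun i)).pos ⟨t.pos i, t.pos_lt h i⟩, (s (t.toFun i)).pos_lt (hs _) _⟩ : ℕ) <
      ((r v ((s v).toFun x)).toFun ⟨(s v).pos x, (s v).pos_lt (hs _) _⟩ : ℕ) := by
    intro v hv x
    subst hv
    rw [← Fin.lt_def, subst_lt_iff, Fin.lt_def, Fin.ext_iff]
  constructor
  · rintro ((h1 | ⟨h1, h2⟩) | ⟨⟨h1, h2⟩, h3⟩)
    · exact Or.inl h1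
    · exact Or.inr ⟨h1, (key2 _ h1 _).2 (Or.inl h2)⟩
    · exact Or.inr ⟨h1, (key2 _ h1 _).2 (Or.inr ⟨h2, h3⟩)⟩
  · rintro (h1 | ⟨h1, h2⟩)
    · exact Or.inl (Or.inl h1)
    · rcases (key2 _ h1 _).1 h2 with h2 | ⟨h2, h3⟩
      · exact Or.inl (Or.inr ⟨h1, h2⟩)
      · exact Or.inr ⟨⟨h1, h2⟩, h3⟩

theorem corolla_subst (n : ℕ) (s : Surj (n + 1)) :
    (corolla n).subst (fun _ => n + 1) (corolla_hasType n) (fun _ => s) = s := by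
  have hp : ∀ i, (corolla n).pos i = i := by
    intro i
    simp only [pos, corolla, true_and]
    have : (Finset.univ.filter fun j => j < i) = Finset.Iio i := by ext; simp
    rw [this, Fin.card_Iio]
  apply ext_of_lt_iff
  intro i j
  rw [subst_lt_iff]
  simp only [hp]
  simp [corolla]

end Surj

/-- A graded permutad over `K`, given by its composition maps. The module `op n` is the module of
operations of arity `n + 1`, i.e. those that may decorate a vertex with `n` inputs. For a
surjective map `t` whose `v`-th fibre has `a v` elements, `Γ t a h` is the composition
`⨂_v 𝒫_{a v + 1} → 𝒫_{n + 1}`, as a multilinear map. Together, these maps form a structure map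
`ℙ(𝒫) → 𝒫`, and `Γ_corolla` and `Γ_subst` say that it is unital and
compatible with substitution. The homological grading is an internal `ℤ`-grading which is
preserved by the composition maps. -/
structure GradedPermutad (K : Type u) [CommRing K] where
  op : ℕ → Type v
  [addCommGroup : ∀ n, AddCommGroup (op n)]
  [module : ∀ n, Module K (op n)]
  deg : ∀ n, ℤ → Submodule K (op n)
  isInternal_deg : ∀ n, DirectSum.IsInternal (deg n)
  Γ : ∀ {n : ℕ} (t : Surj n) (a : Fin t.size → ℕ), t.HasType a →
    MultilinearMap K (fun v => op (a v)) (op n)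
  Γ_mem_deg : ∀ {n : ℕ} (t : Surj n) (a : Fin t.size → ℕ) (h : t.HasType a)
    (e : Fin t.size → ℤ) (x : ∀ v, op (a v)), (∀ v, x v ∈ deg (a v) (e v)) →
      Γ t a h x ∈ deg n (∑ v, e v)
  Γ_corolla : ∀ (n : ℕ) (x : op (n + 1)),
    Γ (Surj.corolla n) (fun _ => n + 1) (Surj.corolla_hasType n) (fun _ => x) = x
  Γ_subst : ∀ {n : ℕ} (t : Surj n) (a : Fin t.size → ℕ) (h : t.HasType a)
    (s : ∀ j, Surj (a j)) (b : ∀ j, Fin (s j).size → ℕ) (hs : ∀ j, (s j).HasType (b j))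
    (x : ∀ j v, op (b j v)),
    Γ (t.subst a h s) (t.substType a h s b) (t.subst_hasType a h s b hs)
        (fun w => x (t.substVertex a h s w).1 (t.substVertex a h s w).2) =
      Γ t a h (fun j => Γ (s j) (b j) (hs j) (x j))
  /-- In arity one, `𝒫₁ = K id`, where `id` is the composition along the empty map. -/
  bijective_smul_id : Function.Bijective fun c : K =>
    c • Γ Surj.empty (fun _ => 0) (Surj.empty_hasType _) (fun v => Fin.elim0 v)

namespace GradedPermutad

attribute [instance] addCommGroup module

variable {K : Type u} [CommRing K]

/-- A morphism of graded permutads. -/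
structure Hom (P : GradedPermutad.{u, v} K) (Q : GradedPermutad.{u, w} K) where
  toLin : ∀ n, P.op n →ₗ[K] Q.op n
  map_deg : ∀ (n : ℕ) (i : ℤ) (x : P.op n), x ∈ P.deg n i → toLin n x ∈ Q.deg n i
  map_Γ : ∀ {n : ℕ} (t : Surj n) (a : Fin t.size → ℕ) (h : t.HasType a) (x : ∀ v, P.op (a v)),
    toLin n (P.Γ t a h x) = Q.Γ t a h (fun v => toLin (a v) (x v))

/-- `P` is the free graded permutad on the family of generators `g x ∈ P.op (inputs x)`,
of homological degree `degree x`. -/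
def IsFreeOn (P : GradedPermutad.{u, v} K) {X : Type x} (inputs : X → ℕ) (degree : X → ℤ)
    (g : ∀ x, P.op (inputs x)) : Prop :=
  (∀ x, g x ∈ P.deg (inputs x) (degree x)) ∧
  ∀ (Q : GradedPermutad.{u, w} K) (q : ∀ x, Q.op (inputs x)),
    (∀ x, q x ∈ Q.deg (inputs x) (degree x)) →
      ∃! f : Hom P Q, ∀ x, f.toLin (inputs x) (g x) = q x

/-- `d` is a derivation of degree `-1` of the graded permutad `P`:
`d Γ(t; x₁, …, x_k) = ∑ᵢ (-1)^{|x₁| + ⋯ + |x_{i-1}|} Γ(t; x₁, …, d xᵢ, …, x_k)`. -/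
structure IsDerivation (P : GradedPermutad.{u, v} K) (d : ∀ n, P.op n →ₗ[K] P.op n) : Prop where
  mem_deg : ∀ (n : ℕ) (i : ℤ) (x : P.op n), x ∈ P.deg n i → d n x ∈ P.deg n (i - 1)
  leibniz : ∀ {n : ℕ} (t : Surj n) (a : Fin t.size → ℕ) (h : t.HasType a)
    (e : Fin t.size → ℤ) (x : ∀ v, P.op (a v)), (∀ v, x v ∈ P.deg (a v) (e v)) →
      d n (P.Γ t a h x) =
        ∑ v, ((∑ w ∈ Finset.univ.filter (· < v), e w).negOnePow : ℤ) •
          P.Γ t a h (Function.update x v (d (a v) (x v)))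

/-- `(P, d)` is a differential graded permutad: each `(P.op n, d n)` is a chain complex, and the
composition maps are morphisms of chain complexes. -/
structure IsDG (P : GradedPermutad.{u, v} K) (d : ∀ n, P.op n →ₗ[K] P.op n) : Prop
    extends P.IsDerivation d where
  sq_zero : ∀ (n : ℕ) (x : P.op n), d n (d n x) = 0

end GradedPermutad

section PermAsInf

variable (K : Type u) [CommRing K]

/-- The submodule spanned by the surjective maps of homological degree `i`. When each vertex with
`a v` inputs is decorated by the generator of degree `a v - 1`, a surjective map from
a set with `n` elements onto a set with `k` elements has degree `∑ (a v - 1) = n - k`. -/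
def surjDeg (n : ℕ) (i : ℤ) : Submodule K (Surj n →₀ K) :=
  Finsupp.supported K K {t | (n : ℤ) - t.size = i}

/-- The composition maps of the free permutad on one generator in each arity `≥ 2`: the
multilinear extension of the substitution of surjective maps. -/
def surjΓ {n : ℕ} (t : Surj n) (a : Fin t.size → ℕ) (h : t.HasType a) :
    MultilinearMap K (fun v => Surj (a v) →₀ K) (Surj n →₀ K) :=
  ∑ s : ∀ v, Surj (a v),
    ((MultilinearMap.mkPiAlgebra K (Fin t.size) K).compLinearMap
      fun v => Finsupp.lapply (s v)).smulRight (Finsupp.single (t.subst a h s) 1)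

theorem surjΓ_apply {n : ℕ} (t : Surj n) (a : Fin t.size → ℕ) (h : t.HasType a)
    (x : ∀ v, Surj (a v) →₀ K) :
    surjΓ K t a h x = ∑ s : ∀ v, Surj (a v),
      (∏ v, x v (s v)) • Finsupp.single (t.subst a h s) (1 : K) := by
  simp [surjΓ]

theorem surjΓ_single {n : ℕ} (t : Surj n) (a : Fin t.size → ℕ) (h : t.HasType a)
    (s : ∀ v, Surj (a v)) :
    surjΓ K t a h (fun v => Finsupp.single (s v) 1) = Finsupp.single (t.subst a h s) 1 := by
  classical
  rw [surjΓ_apply, Finset.sum_eq_single s]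
  · simp
  · intro r _ hr
    obtain ⟨v, hv⟩ := Function.ne_iff.1 hr
    rw [Finset.prod_eq_zero (Finset.mem_univ v), zero_smul]
    rw [Finsupp.single_apply, if_neg (Ne.symm hv)]
  · simp

theorem surjDeg_isInternal (n : ℕ) : DirectSum.IsInternal (surjDeg K n) := by
  rw [DirectSum.isInternal_submodule_iff_iSupIndep_and_iSup_eq_top]
  constructor
  · intro i
    have : (⨆ j, ⨆ (_ : j ≠ i), surjDeg K n j) ≤
        Finsupp.supported K K {t : Surj n | (n : ℤ) - t.size ≠ i} := by
      refine iSup₂_le fun j hj => Finsupp.supported_mono ?_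
      intro t ht
      exact fun hi => hj (ht.symm.trans hi)
    refine Disjoint.mono_right this ?_
    refine Finsupp.disjoint_supported_supported (Set.disjoint_left.2 fun t ht ht' => ht' ht)
  · rw [eq_top_iff]
    intro x _
    induction x using Finsupp.induction_linear with
    | zero => exact Submodule.zero_mem _
    | add f g hf hg => exact Submodule.add_mem _ (hf trivial) (hg trivial)
    | single t c =>
      exact Submodule.mem_iSup_of_mem ((n : ℤ) - t.size)
        (Finsupp.single_mem_supported K c rfl)

theorem surjΓ_mem_deg {n : ℕ} (t : Surj n) (a : Fin t.size → ℕ) (h : t.HasType a)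
    (e : Fin t.size → ℤ) (x : ∀ v, Surj (a v) →₀ K) (hx : ∀ v, x v ∈ surjDeg K (a v) (e v)) :
    surjΓ K t a h x ∈ surjDeg K n (∑ v, e v) := by
  rw [surjΓ_apply]
  refine Submodule.sum_mem _ fun s _ => ?_
  by_cases hs : ∀ v, x v (s v) ≠ 0
  · refine Submodule.smul_mem _ _ (Finsupp.single_mem_supported K _ ?_)
    have h1 : ∀ v, (a v : ℤ) - (s v).size = e v := fun v =>
      hx v (Finsupp.mem_support_iff.2 (hs v))
    change (n : ℤ) - ((∑ v, (s v).size : ℕ) : ℤ) = ∑ v, e v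
    have h2 : (n : ℤ) = ∑ v, (a v : ℤ) := by exact_mod_cast (t.sum_type h).symm
    rw [h2, Nat.cast_sum, ← Finset.sum_sub_distrib]
    exact Finset.sum_congr rfl fun v _ => h1 v
  · push Not at hs
    obtain ⟨v, hv⟩ := hs
    rw [Finset.prod_eq_zero (Finset.mem_univ v) hv, zero_smul]
    exact Submodule.zero_mem _

theorem surjΓ_corolla (n : ℕ) (x : Surj (n + 1) →₀ K) :
    surjΓ K (Surj.corolla n) (fun _ => n + 1) (Surj.corolla_hasType n) (fun _ => x) = x := by
  rw [surjΓ_apply]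
  let e : Surj (n + 1) ≃ (Fin (Surj.corolla n).size → Surj (n + 1)) :=
    (Equiv.funUnique (Fin 1) (Surj (n + 1))).symm
  rw [← e.sum_comp]
  have h1 : ∀ s : Surj (n + 1),
      (∏ v, x (e s v)) • Finsupp.single ((Surj.corolla n).subst (fun _ => n + 1)
        (Surj.corolla_hasType n) (e s)) (1 : K) = Finsupp.single s (x s) := by
    intro s
    have h2 : ∏ v, x (e s v) = x s := Fin.prod_univ_one (fun _ => x s)
    have h3 : e s = fun _ => s := rfl
    rw [h2, h3, Surj.corolla_subst, Finsupp.smul_single, smul_eq_mul, mul_one]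
  rw [Finset.sum_congr rfl fun s _ => h1 s]
  exact Finsupp.univ_sum_single x

theorem surjΓ_subst {n : ℕ} (t : Surj n) (a : Fin t.size → ℕ) (h : t.HasType a)
    (s : ∀ j, Surj (a j)) (b : ∀ j, Fin (s j).size → ℕ) (hs : ∀ j, (s j).HasType (b j))
    (x : ∀ j v, Surj (b j v) →₀ K) :
    surjΓ K (t.subst a h s) (t.substType a h s b) (t.subst_hasType a h s b hs)
        (fun w => x (t.substVertex a h s w).1 (t.substVertex a h s w).2) =
      surjΓ K t a h (fun j => surjΓ K (s j) (b j) (hs j) (x j)) := by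
  have hR : surjΓ K t a h (fun j => surjΓ K (s j) (b j) (hs j) (x j)) =
      ∑ r : ∀ j v, Surj (b j v), (∏ j, ∏ v, x j v (r j v)) •
        Finsupp.single (t.subst a h fun j => (s j).subst (b j) (hs j) (r j)) (1 : K) := by
    simp_rw [fun j => surjΓ_apply K (s j) (b j) (hs j) (x j)]
    rw [MultilinearMap.map_sum]
    refine Finset.sum_congr rfl fun r _ => ?_
    rw [MultilinearMap.map_smul_univ, surjΓ_single]
  rw [hR, surjΓ_apply]
  let sv := t.substVertex a h s
  let e : (∀ j v, Surj (b j v)) ≃ (∀ w, Surj (t.substType a h s b w)) :=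
    (Equiv.piCurry fun j v => Surj (b j v)).symm.trans
      (Equiv.piCongrLeft' (fun p : Σ j, Fin (s j).size => Surj (b p.1 p.2)) sv.symm)
  rw [← e.sum_comp]
  refine Finset.sum_congr rfl fun r _ => ?_
  have he : e r = fun w => r (sv w).1 (sv w).2 := rfl
  have h1 : ∏ w, x (sv w).1 (sv w).2 (e r w) = ∏ j, ∏ v, x j v (r j v) := by
    rw [he, ← Fintype.prod_sigma' fun j v => x j v (r j v)]
    exact sv.prod_comp fun p => x p.1 p.2 (r p.1 p.2)
  rw [← Surj.subst_subst t a h s b hs r]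
  exact congrArg₂ _ h1 rfl

theorem surj_bijective_smul_id : Function.Bijective fun c : K =>
    c • surjΓ K Surj.empty (fun _ => 0) (Surj.empty_hasType _) (fun v => Fin.elim0 v) := by
  have huniq : ∀ t : Surj 0, t = Surj.empty := fun t => Surj.ext_of_lt_iff fun i => Fin.elim0 i
  have h1 : surjΓ K Surj.empty (fun _ => 0) (Surj.empty_hasType _) (fun v => Fin.elim0 v) =
      Finsupp.single Surj.empty 1 := by
    have := surjΓ_single K Surj.empty (fun _ => 0) (Surj.empty_hasType _)
      (fun _ => Surj.empty)
    rw [huniq (Surj.subst _ _ _ _)] at this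
    rw [← this]
    congr 1
    funext v
    exact Fin.elim0 v
  rw [h1]
  constructor
  · intro c c' hc
    simpa using congrArg (fun f : Surj 0 →₀ K => f Surj.empty) hc
  · intro f
    refine ⟨f Surj.empty, ?_⟩
    ext t
    rw [huniq t]
    simp

/-- The graded permutad `permAs_∞`: the free permutad `ℙ(V)` on the graded module `V` which is
`K m_n`, with `m_n` of homological degree `n - 2`, in each arity `n ≥ 2`, and zero in arity `1`.
Since `V_n` is free of rank one, `ℙ(V)_{n+1} = ⨁_t ⨂_v V_{|v|}` is the free module on the
surjective maps `t` with source `{1, …, n}`, where `t` stands for `t` with all its vertices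
decorated by generators. -/
def permAsInf : GradedPermutad.{u, u} K where
  op n := Surj n →₀ K
  deg n i := surjDeg K n i
  isInternal_deg n := surjDeg_isInternal K n
  Γ t a h := surjΓ K t a h
  Γ_mem_deg t a h e x hx := surjΓ_mem_deg K t a h e x hx
  Γ_corolla n x := surjΓ_corolla K n x
  Γ_subst t a h s b hs x := surjΓ_subst K t a h s b hs x
  bijective_smul_id := surj_bijective_smul_id K

/-- The generator `m_{n+2}` of `permAs_∞`, of arity `n + 2`, is the corolla with `n + 1` inputs. -/
def gen (n : ℕ) : (permAsInf K).op (n + 1) :=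
  (Finsupp.single (Surj.corolla n) 1 : Surj (n + 1) →₀ K)

/-- The sign `sgn(t) = sgn(σ_t) (-1)^{#t⁻¹(1)}` of a map `t` with target `{1, 2}`
(here `Fin 2`, so that the vertex `1` is `0 : Fin 2`). The shuffle `σ_t` is the permutation which
lists the elements of `t⁻¹(1)` in increasing order, followed by those of
`t⁻¹(2)` in increasing order. This is the permutation `Tuple.sort t`. -/
def sgn {n : ℕ} (t : Fin n → Fin 2) : ℤ :=
  Equiv.Perm.sign (Tuple.sort t) * (-1) ^ (Finset.univ.filter fun i => t i = 0).card

open Classical in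
/-- The boundary `∑ sgn(t) t` of the big cell of the permutohedron `P^{n}`, as an
element of `permAs_∞`; the sum is over all surjective maps `t` with target `{1, 2}`. -/
def bigCellBoundary (n : ℕ) : (permAsInf K).op (n + 1) :=
  ∑ t : {f : Fin (n + 1) → Fin 2 // Function.Surjective f},
    sgn t.1 • (Finsupp.single (⟨2, t.1, t.2⟩ : Surj (n + 1)) 1 : Surj (n + 1) →₀ K)

end PermAsInf

section Cellular

/-- A nonempty face of the convex set `P` (including `P` itself): a nonempty set of the points of `P`
at which some linear functional attains its maximum over `P`. For a polytope
these are the closed cells of its cell structure. -/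
@[ext]
structure Face {E : Type*} [AddCommGroup E] [Module ℝ E] [TopologicalSpace E] (P : Set E) where
  carrier : Set E
  nonempty : carrier.Nonempty
  isExposed : IsExposed ℝ P carrier

namespace Face

variable {E : Type*} [AddCommGroup E] [Module ℝ E] [TopologicalSpace E] {P : Set E}

/-- The linear subspace parallel to the affine span of a face. -/
def direction (F : Face P) : Submodule ℝ E := vectorSpan ℝ F.carrier

/-- The dimension of a face. -/
def dim (F : Face P) : ℕ := Module.finrank ℝ F.direction

/-- `G` is a facet of `F`, i.e. a face of `F` of codimension one. -/
def IsFacet (G F : Face P) : Prop := G.carrier ⊆ F.carrier ∧ F.dim = G.dim + 1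

theorem IsFacet.direction_le {F G : Face P} (h : G.IsFacet F) : G.direction ≤ F.direction :=
  vectorSpan_mono ℝ h.1

theorem IsFacet.exists_mem_diff {F G : Face P} (h : G.IsFacet F) :
    (F.carrier \ G.carrier).Nonempty := by
  rw [Set.sdiff_nonempty]
  intro hFG
  have : F = G := Face.ext (Set.Subset.antisymm hFG h.1)
  have h2 := h.2
  rw [this] at h2
  omega

/-- A vector in the direction of `F`, pointing from a point of `F` outside `G` to a point of
the facet `G`. Modulo the direction of `G`, any two choices agree up to a positive factor. -/
def IsFacet.outward {F G : Face P} (h : G.IsFacet F) : F.direction :=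
  ⟨G.nonempty.some -ᵥ h.exists_mem_diff.some,
    vsub_mem_vectorSpan ℝ (h.1 G.nonempty.some_mem) h.exists_mem_diff.some_mem.1⟩

end Face

variable {E : Type*} [AddCommGroup E] [Module ℝ E] [TopologicalSpace E]

/-- An orientation of each face of `P`, represented by an ordered basis of its direction. -/
def FaceOrientation (P : Set E) : Type _ :=
  ∀ F : Face P, Module.Basis (Fin F.dim) ℝ F.direction

open Classical in
/-- The incidence number `[F : G]`: it is zero unless `G` is a facet of `F`; in that case it is `1`
or `-1`, according to whether or not an outward vector followed by the
oriented basis of `G` is a positively oriented basis of `F`. -/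
def incidence {P : Set E} (o : FaceOrientation P) (F G : Face P) : ℤ :=
  if h : G.IsFacet F then
    SignType.sign (((o F).reindex (finCongr h.2)).det
      (Fin.cons h.outward fun i => Submodule.inclusion h.direction_le (o G i)))
  else 0

/-- The boundary map `F ↦ ∑ [F : G] G` of the cellular chain complex of the polytope `P` with
coefficients in `K`, on the module of cellular chains of all degrees, which is the
free module on the (finitely many) faces of `P`. -/
def cellularBoundary (K : Type*) [CommRing K] {P : Set E} (o : FaceOrientation P) :
    (Face P →₀ K) →ₗ[K] (Face P →₀ K) :=
  Finsupp.linearCombination K fun F => ∑ᶠ G, incidence o F G • Finsupp.single G (1 : K)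

/-- The cellular chains of degree `i`: the span of the faces of dimension `i`. -/
def cellularChains (K : Type*) [CommRing K] (P : Set E) (i : ℤ) : Submodule K (Face P →₀ K) :=
  Finsupp.supported K K {F | (F.dim : ℤ) = i}

/-- The permutohedron `P^n`: the convex hull in `ℝ^{n+1}` of the points
`(σ(1), …, σ(n+1))`, for all permutations `σ` of `{1, …, n+1}`. -/
def permutohedron (n : ℕ) : Set (Fin (n + 1) → ℝ) :=
  convexHull ℝ (Set.range fun (σ : Equiv.Perm (Fin (n + 1))) i => ((σ i : ℕ) : ℝ) + 1)

/-- The cell of the permutohedron which corresponds to a surjective map `t`: the convex hull of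
the vertices `(σ(1), …, σ(n+1))` such that `σ(i) < σ(j)` whenever `t(i) < t(j)`. -/
def permutohedronCell {n : ℕ} (t : Surj (n + 1)) : Set (Fin (n + 1) → ℝ) :=
  convexHull ℝ ((fun (σ : Equiv.Perm (Fin (n + 1))) i => ((σ i : ℕ) : ℝ) + 1) ''
    {σ | ∀ i j, t.toFun i < t.toFun j → σ i < σ j})

end Cellular

end

/-! Everything is governed by one relation: `Covers J T' T`, where `T'` splits the vertex `J` of `T`
into the vertices `J` and `J + 1`. The differential sends `T` to the sum of `κ T * κ T' * (-1) ^ J`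
times `T'` over all such splittings. Once the basis is rescaled by the signs `κ`, this is an
alternating sum dual to the merging of consecutive vertices. Merges satisfy the simplicial
identities, so `d² = 0` (`sum_bdryCoeff_mul`).

The sign `κ` is chosen so that `κ T * κ T'` sees only the inversions between the two halves of the
split vertex and the number of inputs lying at or before the cut (`Covers.κ_mul_κ`). For a corolla
this gives the prescribed boundary. For a composite, a splitting takes place inside exactly one
piece, and the inputs and vertices of the earlier pieces contribute the parity of their total
degree, which is the Leibniz sign (`Covers.sign_subst_update`). Uniqueness of the derivation and
freeness both follow from `subst_cor`: every surjection is a composite of corollas along itself. The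
extension forced by this is a morphism because composition in the target is compatible with
substitution.

On the geometric side, the rearrangement inequality shows that a linear functional with coefficients
`c` is maximal exactly at the vertices whose permutation is increasing with respect to `c`. Exposed
faces therefore correspond to ordered level-set partitions of the inputs, i.e. to surjections. The
cell of `t` is parallel to the kernel of the sums over the fibres (`direction_cellFace`), so facets
correspond to covers.

The indicators of the fibres, in order, complete an oriented basis of a cell to a basis of the whole
space, and the sign of the determinant is `cellSign`. Modulo the facet, an outward vector is `α •
1_J + β • 1_{J+1}` with `α < 0 < β`. The resulting determinant comparison gives the incidence number
`(-1) ^ (k + J + 1)`, up to `cellSign`s, for a cell with `k` vertices of its surjection. The factor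
depending on `k` is absorbed by `sizeSign`, so a signed bijection of bases is a chain map, and `∂² =
0` is inherited from `d² = 0`. -/

noncomputable section

/-! ### Splittings of a vertex, their signs, and the vanishing of the square. -/

namespace Surj

variable {n : ℕ}

/-- The vertex over which an input lies, as a natural number. -/
def val (t : Surj n) (i : Fin n) : ℕ := t.toFun i

theorem val_lt (t : Surj n) (i : Fin n) : t.val i < t.size := (t.toFun i).2

theorem exists_val_eq (t : Surj n) {v : ℕ} (hv : v < t.size) : ∃ i, t.val i = v := by
  obtain ⟨i, hi⟩ := t.surjective ⟨v, hv⟩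
  exact ⟨i, congrArg Fin.val hi⟩

theorem ext_val {s t : Surj n} (h : ∀ i, s.val i = t.val i) : s = t :=
  ext_of_lt_iff fun i j => by
    rw [Fin.lt_def, Fin.lt_def]
    change s.val i < s.val j ↔ t.val i < t.val j
    rw [h, h]

/-- The surjective map given by a function with values in the natural numbers. -/
def ofVal (f : Fin n → ℕ) (k : ℕ) (hf : ∀ i, f i < k) (hs : ∀ v < k, ∃ i, f i = v) : Surj n where
  size := k
  toFun i := ⟨f i, hf i⟩
  surjective v := by
    obtain ⟨i, hi⟩ := hs v v.2
    exact ⟨i, Fin.ext hi⟩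

@[simp] theorem ofVal_size (f : Fin n → ℕ) (k : ℕ) (hf : ∀ i, f i < k)
    (hs : ∀ v < k, ∃ i, f i = v) : (ofVal f k hf hs).size = k := rfl

@[simp] theorem ofVal_val (f : Fin n → ℕ) (k : ℕ) (hf : ∀ i, f i < k)
    (hs : ∀ v < k, ∃ i, f i = v) (i : Fin n) : (ofVal f k hf hs).val i = f i := rfl

/-- `T` is obtained from `T'` by merging the consecutive vertices `J` and `J + 1`. -/
def Covers (J : ℕ) (T' T : Surj n) : Prop :=
  T'.size = T.size + 1 ∧ J < T.size ∧
    ∀ i, T.val i = if T'.val i ≤ J then T'.val i else T'.val i - 1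

/-- The number of inversions of `t` plus the sum of the numbers of inputs
over the proper initial segments of the vertices. -/
def signExp (t : Surj n) : ℕ :=
  (Finset.univ.filter fun p : Fin n × Fin n => p.1 < p.2 ∧ t.val p.2 < t.val p.1).card +
    ∑ i, (t.size - 1 - t.val i)

/-- The sign by which the boundary of `permAs_∞` differs from that of a simplicial object. -/
def κ (t : Surj n) : ℤ := (-1) ^ t.signExp

theorem κ_mul_self (t : Surj n) : t.κ * t.κ = 1 := by
  rw [κ, ← pow_add, ← two_mul, pow_mul]; simp

/-- The exponent of the sign of the refinement `t'` of `t` at the vertex `J`. -/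
def cutExp (J : ℕ) (t' : Surj n) : ℕ :=
  (Finset.univ.filter fun p : Fin n × Fin n =>
    p.1 < p.2 ∧ t'.val p.1 = J + 1 ∧ t'.val p.2 = J).card +
  (Finset.univ.filter fun i => t'.val i ≤ J).card

/-- Splitting a vertex creates only the inversions between its two halves, and one new proper
initial segment of vertices, the one ending at `J`. -/
theorem Covers.signExp_eq {J : ℕ} {T' T : Surj n} (h : Covers J T' T) :
    T'.signExp = T.signExp + cutExp J T' := by
  obtain ⟨h1, h2, h3⟩ := h
  have e1 : ∑ i, (T'.size - 1 - T'.val i) = ∑ i, (T.size - 1 - T.val i) +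
      (Finset.univ.filter fun i => T'.val i ≤ J).card := by
    rw [Finset.card_filter, ← Finset.sum_add_distrib]
    refine Finset.sum_congr rfl fun i _ => ?_
    have h4 := T.val_lt i
    have h5 := T'.val_lt i
    have h6 := h3 i
    split_ifs at h6 ⊢ <;> omega
  have e2 : (Finset.univ.filter fun p : Fin n × Fin n =>
        p.1 < p.2 ∧ T'.val p.2 < T'.val p.1).card =
      (Finset.univ.filter fun p : Fin n × Fin n => p.1 < p.2 ∧ T.val p.2 < T.val p.1).card +
      (Finset.univ.filter fun p : Fin n × Fin n =>
        p.1 < p.2 ∧ T'.val p.1 = J + 1 ∧ T'.val p.2 = J).card := by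
    simp only [Finset.card_filter]
    rw [← Finset.sum_add_distrib]
    refine Finset.sum_congr rfl fun p _ => ?_
    have h6 := h3 p.1
    have h7 := h3 p.2
    by_cases hp : p.1 < p.2
    · simp only [hp, true_and]
      split_ifs at * <;> omega
    · simp [hp]
  rw [signExp, signExp, cutExp, e1, e2]
  omega

theorem Covers.κ_mul_κ {J : ℕ} {T' T : Surj n} (h : Covers J T' T) :
    T.κ * T'.κ = (-1) ^ cutExp J T' := by
  rw [κ, κ, h.signExp_eq, pow_add, ← mul_assoc, ← pow_add, ← two_mul, pow_mul]; simp

/-- An input over the larger of two distinct indices tells the merges apart: the merge at the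
smaller index lowers its value, the other one keeps it. -/
theorem Covers.unique {J J' : ℕ} {T' T : Surj n} (h : Covers J T' T) (h' : Covers J' T' T) :
    J = J' := by
  obtain ⟨h1, h2, h3⟩ := h
  obtain ⟨-, h5, h6⟩ := h'
  rcases lt_trichotomy J J' with hl | rfl | hl
  · obtain ⟨i, hi⟩ := T'.exists_val_eq (v := J') (by omega)
    have := h3 i
    have := h6 i
    split_ifs at * <;> omega
  · rfl
  · obtain ⟨i, hi⟩ := T'.exists_val_eq (v := J) (by omega)
    have := h3 i
    have := h6 i
    split_ifs at * <;> omega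

theorem Covers.eq {J : ℕ} {T' T S : Surj n} (h : Covers J T' T) (h' : Covers J T' S) : T = S :=
  ext_val fun i => by rw [h.2.2, h'.2.2]

/-- Merging two consecutive vertices. -/
def merge (J : ℕ) (t : Surj n) (h : J + 1 < t.size) : Surj n :=
  ofVal (fun i => if t.val i ≤ J then t.val i else t.val i - 1) (t.size - 1)
    (fun i => by have := t.val_lt i; split_ifs <;> omega)
    (fun v hv => by
      by_cases hvJ : v ≤ J
      · obtain ⟨i, hi⟩ := t.exists_val_eq (v := v) (by omega)
        exact ⟨i, by rw [hi, if_pos hvJ]⟩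
      · obtain ⟨i, hi⟩ := t.exists_val_eq (v := v + 1) (by omega)
        exact ⟨i, by rw [hi, if_neg (by omega)]; omega⟩)

theorem merge_size (J : ℕ) (t : Surj n) (h : J + 1 < t.size) : (merge J t h).size = t.size - 1 :=
  rfl

theorem merge_val (J : ℕ) (t : Surj n) (h : J + 1 < t.size) (i : Fin n) :
    (merge J t h).val i = if t.val i ≤ J then t.val i else t.val i - 1 := rfl

theorem covers_merge (J : ℕ) (t : Surj n) (h : J + 1 < t.size) : Covers J t (merge J t h) :=
  ⟨by rw [merge_size]; omega, by rw [merge_size]; omega, fun _ => rfl⟩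

open Classical in
/-- The coefficient of `T'` in the boundary of `T`. -/
def bdryCoeff (T' T : Surj n) : ℤ :=
  ∑ J ∈ Finset.range T.size, if Covers J T' T then T.κ * T'.κ * (-1) ^ J else 0

/-- By `Covers.unique`, the sum defining `bdryCoeff` has at most one nonzero term; summing over `J`
avoids choosing it. -/
theorem Covers.bdryCoeff_eq {J : ℕ} {T' T : Surj n} (h : Covers J T' T) :
    bdryCoeff T' T = T.κ * T'.κ * (-1) ^ J := by
  classical
  rw [bdryCoeff, Finset.sum_eq_single J]
  · rw [if_pos h]
  · intro J' _ hJ'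
    rw [if_neg fun h' => hJ' (h'.unique h)]
  · intro hJ
    exact absurd (Finset.mem_range.2 h.2.1) hJ

theorem bdryCoeff_eq_zero {T' T : Surj n} (h : ∀ J, ¬ Covers J T' T) : bdryCoeff T' T = 0 :=
  Finset.sum_eq_zero fun J _ => if_neg (h J)

theorem size_eq_of_bdryCoeff_ne_zero {T' T : Surj n} (h : bdryCoeff T' T ≠ 0) :
    T'.size = T.size + 1 := by
  by_contra h'
  exact h (bdryCoeff_eq_zero fun J hJ => h' hJ.1)

/-- The simplicial identity behind `d² = 0`. -/
theorem sum_bdryCoeff_mul (T'' T : Surj n) :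
    ∑ T', bdryCoeff T'' T' * bdryCoeff T' T = 0 := by
  classical
  by_cases hsz : T''.size = T.size + 2
  swap
  · refine Finset.sum_eq_zero fun T' _ => ?_
    by_contra h
    have h1 := size_eq_of_bdryCoeff_ne_zero (left_ne_zero_of_mul h)
    have h2 := size_eq_of_bdryCoeff_ne_zero (right_ne_zero_of_mul h)
    omega
  set k := T.size with hk
  let Q : ℕ × ℕ → Prop := fun p => ∃ T', Covers p.1 T'' T' ∧ Covers p.2 T' T
  -- The intermediate surjection is determined by the first merge, so `Q` becomes a condition on
  -- values that `omega` can decide.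
  have hval : ∀ p, p.1 < k + 1 → p.2 < k → (Q p ↔ ∀ i, T.val i =
      if (if T''.val i ≤ p.1 then T''.val i else T''.val i - 1) ≤ p.2 then
        (if T''.val i ≤ p.1 then T''.val i else T''.val i - 1) else
        (if T''.val i ≤ p.1 then T''.val i else T''.val i - 1) - 1) := by
    intro p hp1 hp2
    constructor
    · rintro ⟨T', h1, h2⟩ i
      rw [h2.2.2, h1.2.2]
    · intro h
      have hc := covers_merge p.1 T'' (by omega)
      refine ⟨_, hc, ?_, hp2, h⟩
      rw [merge_size]
      omega
  -- The sign `κ T'` of the intermediate surjection occurs squared and disappears.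
  have key : ∀ T', bdryCoeff T'' T' * bdryCoeff T' T =
      ∑ p ∈ Finset.range (k + 1) ×ˢ Finset.range k,
        if Covers p.1 T'' T' ∧ Covers p.2 T' T then T''.κ * T.κ * (-1) ^ (p.1 + p.2) else 0 := by
    intro T'
    by_cases h2 : T'.size = k + 1
    · rw [bdryCoeff, bdryCoeff, h2, ← hk, Finset.sum_mul_sum, ← Finset.sum_product']
      refine Finset.sum_congr rfl fun p _ => ?_
      rw [ite_and, ite_zero_mul_ite_zero, ← ite_and]
      refine if_congr Iff.rfl ?_ rfl
      calc _ = (T'.κ * T'.κ) * (T''.κ * T.κ * ((-1) ^ p.1 * (-1) ^ p.2)) := by ring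
        _ = _ := by rw [κ_mul_self, one_mul, pow_add]
    · rw [bdryCoeff_eq_zero (T' := T') (T := T) fun J hJ => h2 hJ.1, mul_zero]
      exact (Finset.sum_eq_zero fun p _ => if_neg fun h => h2 h.2.1).symm
  simp_rw [key]
  rw [Finset.sum_comm]
  have key2 : ∀ p : ℕ × ℕ, (∑ T', if Covers p.1 T'' T' ∧ Covers p.2 T' T then
      T''.κ * T.κ * (-1) ^ (p.1 + p.2) else 0) =
      if Q p then T''.κ * T.κ * (-1) ^ (p.1 + p.2) else 0 := by
    intro p
    by_cases hQ : Q p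
    · obtain ⟨T', h1, h2⟩ := hQ
      rw [if_pos ⟨T', h1, h2⟩, Finset.sum_eq_single T', if_pos ⟨h1, h2⟩]
      · intro S _ hS
        exact if_neg fun h => hS (h.1.eq h1)
      · simp
    · rw [if_neg hQ]
      exact Finset.sum_eq_zero fun S _ => if_neg fun h => hQ ⟨S, h⟩
  rw [Finset.sum_congr rfl fun p _ => key2 p]
  -- For `J' ≤ J`, merging at `J'` and then at `J` equals merging at `J + 1` and then at `J'`. The
  -- exponents `J' + J` and `J + 1 + J'` have opposite parity, so paired terms cancel.
  refine Finset.sum_involution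
    (fun p _ => if p.1 ≤ p.2 then (p.2 + 1, p.1) else (p.2, p.1 - 1)) ?_ ?_ ?_ ?_
  · rintro ⟨J', J⟩ hp
    simp only [Finset.mem_product, Finset.mem_range] at hp
    have hq : Q (J', J) ↔ Q (if J' ≤ J then (J + 1, J') else (J, J' - 1)) := by
      rw [hval _ hp.1 hp.2, hval]
      · refine forall_congr' fun i => ?_
        by_cases hJ : J' ≤ J
        · simp only [hJ, if_true]
          split_ifs <;> omega
        · simp only [hJ, if_false]
          split_ifs <;> omega
      · split_ifs <;> simp only <;> omega
      · split_ifs <;> simp only <;> omega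
    simp only
    rw [if_congr hq.symm rfl rfl]
    by_cases hQ : Q (J', J)
    · rw [if_pos hQ, if_pos hQ]
      by_cases hJ : J' ≤ J
      · simp only [hJ, if_true]
        rw [show J + 1 + J' = (J' + J) + 1 by omega, pow_succ]
        ring
      · simp only [hJ, if_false]
        rw [show J' + J = (J + (J' - 1)) + 1 by omega, pow_succ]
        ring
    · rw [if_neg hQ, if_neg hQ, add_zero]
  · rintro ⟨J', J⟩ hp _ h
    simp only at h
    split_ifs at h <;> simp only [Prod.mk.injEq] at h <;> omega
  · rintro ⟨J', J⟩ hp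
    simp only [Finset.mem_product, Finset.mem_range] at hp ⊢
    split_ifs <;> simp only <;> omega
  · rintro ⟨J', J⟩ hp
    simp only
    by_cases hJ : J' ≤ J
    · simp only [hJ, if_true]
      rw [if_neg (by omega)]
      simp
    · simp only [hJ, if_false]
      rw [if_pos (by omega)]
      exact Prod.ext (by simp only; omega) rfl

end Surj

/-! ### Splittings of a composite. -/

namespace Surj

variable {n : ℕ}

theorem finSigma_val {m : ℕ} {f : Fin m → ℕ} (x : Σ j, Fin (f j)) :
    (finSigmaFinEquiv x : ℕ) = ∑ u ∈ Finset.univ.filter (· < x.1), f u + x.2 := by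
  rw [finSigmaFinEquiv_apply]
  congr 1
  refine Finset.sum_bij (fun i _ => Fin.castLE x.1.2.le i) ?_ ?_ ?_ ?_
  · intro i _
    simp only [Finset.mem_filter, Finset.mem_univ, true_and]
    exact i.2
  · intro i _ j _ h
    simpa using h
  · intro j hj
    simp only [Finset.mem_filter, Finset.mem_univ, true_and] at hj
    exact ⟨⟨j, hj⟩, Finset.mem_univ _, rfl⟩
  · intro i _
    rfl

theorem subst_val (t : Surj n) (a : Fin t.size → ℕ) (h : t.HasType a) (s : ∀ j, Surj (a j))
    (i : Fin n) : (t.subst a h s).val i =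
      ∑ u ∈ Finset.univ.filter (· < t.toFun i), (s u).size +
        (s (t.toFun i)).val ⟨t.pos i, t.pos_lt h i⟩ :=
  finSigma_val _

theorem subst_size (t : Surj n) (a : Fin t.size → ℕ) (h : t.HasType a) (s : ∀ j, Surj (a j)) :
    (t.subst a h s).size = ∑ u, (s u).size := rfl

/-- The inclusion of a fibre, in increasing order. -/
def fibre (t : Surj n) {a : Fin t.size → ℕ} (h : t.HasType a) (v : Fin t.size) (b : Fin (a v)) :
    Fin n :=
  (Equiv.ofBijective _ (t.locate_bijective h)).symm ⟨v, b⟩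

section fibre

variable (t : Surj n) {a : Fin t.size → ℕ} (h : t.HasType a)

theorem locate_fibre (v : Fin t.size) (b : Fin (a v)) :
    t.locate h (t.fibre h v b) = ⟨v, b⟩ :=
  (Equiv.ofBijective _ (t.locate_bijective h)).apply_symm_apply _

theorem toFun_fibre (v : Fin t.size) (b : Fin (a v)) : t.toFun (t.fibre h v b) = v :=
  congrArg Sigma.fst (t.locate_fibre h v b)

theorem pos_fibre (v : Fin t.size) (b : Fin (a v)) : t.pos (t.fibre h v b) = b :=
  congrArg (fun p : Σ v : Fin t.size, Fin (a v) => (p.2 : ℕ)) (t.locate_fibre h v b)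

theorem fibre_pos (i : Fin n) : t.fibre h (t.toFun i) ⟨t.pos i, t.pos_lt h i⟩ = i := by
  rw [fibre, Equiv.symm_apply_eq]
  rfl

theorem exists_fibre_eq {v : Fin t.size} {i : Fin n} (hi : t.toFun i = v) :
    ∃ b, t.fibre h v b = i := by
  subst hi
  exact ⟨_, t.fibre_pos h i⟩

theorem fibre_lt_iff (v : Fin t.size) (b c : Fin (a v)) :
    t.fibre h v b < t.fibre h v c ↔ b < c := by
  rw [← t.pos_lt_pos_iff (by rw [toFun_fibre, toFun_fibre]), pos_fibre, pos_fibre, Fin.lt_def]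

theorem fibre_injective (v : Fin t.size) : Function.Injective (t.fibre h v) := by
  intro b c hbc
  have := congrArg t.pos hbc
  rw [pos_fibre, pos_fibre] at this
  exact Fin.ext this

theorem subst_val_fibre (s : ∀ j, Surj (a j)) (v : Fin t.size) (b : Fin (a v)) :
    (t.subst a h s).val (t.fibre h v b) =
      ∑ u ∈ Finset.univ.filter (· < v), (s u).size + (s v).val b := by
  have := congrArg (fun p : Σ v : Fin t.size, Fin (a v) =>
    ∑ u ∈ Finset.univ.filter (· < p.1), (s u).size + (s p.1).val p.2) (t.locate_fibre h v b)
  exact (subst_val _ _ _ _ _).trans this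

/-- Over the fibre of `v` the composite is `s v` shifted by a constant, and a surjection is
determined by the order it induces. -/
theorem subst_injective : Function.Injective (t.subst a h) := by
  intro s s' hss
  have hlt : ∀ v b c, (s v).val b < (s v).val c ↔ (s' v).val b < (s' v).val c := by
    intro v b c
    have h1 := t.subst_val_fibre h s v b
    have h2 := t.subst_val_fibre h s v c
    have h3 := t.subst_val_fibre h s' v b
    have h4 := t.subst_val_fibre h s' v c
    rw [hss] at h1 h2
    omega
  funext v
  exact ext_of_lt_iff (hlt v)

theorem forall_fibre {p : Fin n → Prop} : (∀ i, p i) ↔ ∀ v b, p (t.fibre h v b) :=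
  ⟨fun hp v b => hp _, fun hp i => by rw [← t.fibre_pos h i]; exact hp _ _⟩

end fibre

theorem sum_filter_lt_mono {k : ℕ} (f : Fin k → ℕ) {v w : Fin k} (hvw : v < w) :
    ∑ u ∈ Finset.univ.filter (· < v), f u + f v ≤ ∑ u ∈ Finset.univ.filter (· < w), f u := by
  rw [add_comm, ← Finset.sum_insert (by simp)]
  refine Finset.sum_le_sum_of_subset fun u hu => ?_
  simp only [Finset.mem_insert, Finset.mem_filter, Finset.mem_univ, true_and] at hu ⊢
  rcases hu with rfl | hu
  · exact hvw
  · exact hu.trans hvw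

theorem sum_filter_lt_add_le {k : ℕ} (f : Fin k → ℕ) (v : Fin k) :
    ∑ u ∈ Finset.univ.filter (· < v), f u + f v ≤ ∑ u, f u := by
  rw [add_comm, ← Finset.sum_insert (by simp)]
  exact Finset.sum_le_sum_of_subset (Finset.subset_univ _)

section update

variable (t : Surj n) {a : Fin t.size → ℕ} (h : t.HasType a) (s : ∀ j, Surj (a j))
  {v : Fin t.size} {j : ℕ} {s' : Surj (a v)}

theorem update_size (hs' : s'.size = (s v).size + 1) (u : Fin t.size) :
    (Function.update s v s' u).size = (s u).size + if u = v then 1 else 0 := by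
  by_cases hu : u = v
  · subst hu; simp [hs']
  · simp [hu]

theorem sum_update_size (hs' : s'.size = (s v).size + 1) (w : Fin t.size) :
    ∑ u ∈ Finset.univ.filter (· < w), (Function.update s v s' u).size =
      ∑ u ∈ Finset.univ.filter (· < w), (s u).size + if v < w then 1 else 0 := by
  simp_rw [update_size t s hs', Finset.sum_add_distrib]
  simp

/-- The vertices of `s v` form a block starting after those of the earlier pieces. Splitting one of
them leaves earlier blocks in place and shifts later blocks by one. -/
theorem Covers.subst_update (hc : Covers j s' (s v)) :
    Covers (∑ u ∈ Finset.univ.filter (· < v), (s u).size + j)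
      (t.subst a h (Function.update s v s')) (t.subst a h s) := by
  obtain ⟨h1, h2, h3⟩ := hc
  refine ⟨?_, ?_, ?_⟩
  · rw [subst_size, subst_size]
    simp_rw [update_size t s h1, Finset.sum_add_distrib]
    simp
  · have := sum_filter_lt_add_le (fun u => (s u).size) v
    rw [subst_size]
    omega
  · rw [t.forall_fibre h]
    intro w b
    rw [subst_val_fibre, subst_val_fibre, sum_update_size t s h1]
    rcases lt_trichotomy w v with hw | rfl | hw
    · have := sum_filter_lt_mono (fun u => (s u).size) hw
      have := (s w).val_lt b
      rw [Function.update_of_ne hw.ne, if_neg hw.not_gt, if_pos (by omega)]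
      rfl
    · rw [Function.update_self, if_neg (lt_irrefl _), h3]
      split_ifs <;> omega
    · have := sum_filter_lt_mono (fun u => (s u).size) hw
      rw [Function.update_of_ne hw.ne', if_pos hw, if_neg (by omega)]
      omega

/-- Converse of `Covers.subst_update`: the split vertex lies in the block of `v`, so only the piece
`s v` can have changed. -/
theorem exists_covers_of_covers_subst {T' : Surj n} (hj : j < (s v).size)
    (hc : Covers (∑ u ∈ Finset.univ.filter (· < v), (s u).size + j) T' (t.subst a h s)) :
    ∃ s' : Surj (a v), Covers j s' (s v) ∧ t.subst a h (Function.update s v s') = T' := by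
  obtain ⟨h1, h2, h3⟩ := hc
  set o := ∑ u ∈ Finset.univ.filter (· < v), (s u).size with ho
  have hv : ∀ b, o + (s v).val b = if T'.val (t.fibre h v b) ≤ o + j then
      T'.val (t.fibre h v b) else T'.val (t.fibre h v b) - 1 := by
    intro b
    rw [← h3, subst_val_fibre]
  -- On the fibre of `v`, `hv` forces the values of `T'` to lie between `o` and `o + (s v).size`, so
  -- the subtraction is not truncated. An input with value in this range cannot lie in another
  -- fibre, whence surjectivity.
  let s' : Surj (a v) := ofVal (fun b => T'.val (t.fibre h v b) - o) ((s v).size + 1)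
    (fun b => by
      have := hv b
      have := (s v).val_lt b
      split_ifs at * <;> omega)
    (fun x hx => by
      obtain ⟨i, hi⟩ := T'.exists_val_eq (v := o + x) (by
        have := sum_filter_lt_add_le (fun u => (s u).size) v
        rw [h1, subst_size]
        omega)
      obtain ⟨⟨w, b⟩, rfl⟩ : ∃ p : Σ w, Fin (a w), t.fibre h p.1 p.2 = i :=
        ⟨⟨t.toFun i, _⟩, t.fibre_pos h i⟩
      simp only at hi
      have h4 := h3 (t.fibre h w b)
      rw [subst_val_fibre, hi] at h4
      have h5 := (s w).val_lt b
      rcases lt_trichotomy w v with hw | rfl | hw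
      · have := sum_filter_lt_mono (fun u => (s u).size) hw
        split_ifs at h4 <;> omega
      · exact ⟨b, by omega⟩
      · have := sum_filter_lt_mono (fun u => (s u).size) hw
        split_ifs at h4 <;> omega)
  have hs' : Covers j s' (s v) := by
    refine ⟨rfl, hj, fun b => ?_⟩
    change (s v).val b = if T'.val (t.fibre h v b) - o ≤ j then T'.val (t.fibre h v b) - o else
      T'.val (t.fibre h v b) - o - 1
    have := hv b
    split_ifs at * <;> omega
  refine ⟨s', hs', ext_val ?_⟩
  have h6 := (Covers.subst_update t h s hs').2.2
  rw [t.forall_fibre h]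
  intro w b
  have h7 := h6 (t.fibre h w b)
  rw [h3] at h7
  rcases eq_or_ne w v with rfl | hw
  · rw [subst_val_fibre, sum_update_size t s rfl, Function.update_self, if_neg (lt_irrefl _)]
    change o + (T'.val (t.fibre h w b) - o) = _
    have := hv b
    split_ifs at * <;> omega
  · have h8 := h3 (t.fibre h w b)
    rw [subst_val_fibre] at h8
    have h9 : (t.subst a h (Function.update s v s')).val (t.fibre h w b) =
      ∑ u ∈ Finset.univ.filter (· < w), (s u).size + (if v < w then 1 else 0) +
        (s w).val b := by
      rw [subst_val_fibre, sum_update_size t s rfl, Function.update_of_ne hw]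
    rcases lt_or_gt_of_ne hw with hw | hw
    · have := sum_filter_lt_mono (fun u => (s u).size) hw
      have := (s w).val_lt b
      rw [if_neg hw.not_gt] at h9
      split_ifs at * <;> omega
    · have := sum_filter_lt_mono (fun u => (s u).size) hw
      rw [if_pos hw] at h9
      split_ifs at * <;> omega

theorem card_filter_eq_sum_fibre (p : Fin n → Prop) [DecidablePred p] :
    (Finset.univ.filter p).card =
      ∑ w, (Finset.univ.filter fun b => p (t.fibre h w b)).card := by
  simp_rw [Finset.card_filter]
  rw [← Fintype.sum_sigma' (fun w b => if p (t.fibre h w b) then 1 else 0)]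
  exact ((Equiv.ofBijective _ (t.locate_bijective h)).symm.sum_comp
    fun i => if p i then 1 else 0).symm

/-- Inversions between the two new vertices involve only inputs of the fibre of `v`. The inputs at
or before the cut include, in addition, all inputs of the earlier fibres. -/
theorem cutExp_subst_update (hc : Covers j s' (s v)) :
    cutExp (∑ u ∈ Finset.univ.filter (· < v), (s u).size + j)
      (t.subst a h (Function.update s v s')) =
    ∑ u ∈ Finset.univ.filter (· < v), a u + cutExp j s' := by
  set T' := t.subst a h (Function.update s v s') with hT'
  set o := ∑ u ∈ Finset.univ.filter (· < v), (s u).size with ho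
  have hval : ∀ w b, T'.val (t.fibre h w b) = ∑ u ∈ Finset.univ.filter (· < w), (s u).size +
      (if v < w then 1 else 0) + (Function.update s v s' w).val b := by
    intro w b
    rw [hT', subst_val_fibre, sum_update_size t s hc.1]
  have hv : ∀ b, T'.val (t.fibre h v b) = o + s'.val b := by
    intro b
    rw [hval, Function.update_self, if_neg (lt_irrefl _)]
    rfl
  have hlt : ∀ w, w < v → ∀ b, T'.val (t.fibre h w b) < o := by
    intro w hw b
    have := sum_filter_lt_mono (fun u => (s u).size) hw
    have := (s w).val_lt b
    rw [hval, Function.update_of_ne hw.ne, if_neg hw.not_gt]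
    omega
  have hgt : ∀ w, v < w → ∀ b, o + j + 1 < T'.val (t.fibre h w b) := by
    intro w hw b
    have := sum_filter_lt_mono (fun u => (s u).size) hw
    have := hc.2.1
    rw [hval, if_pos hw]
    omega
  have e1 : (Finset.univ.filter fun i => T'.val i ≤ o + j).card =
      ∑ u ∈ Finset.univ.filter (· < v), a u +
        (Finset.univ.filter fun b => s'.val b ≤ j).card := by
    rw [card_filter_eq_sum_fibre t h, Finset.sum_filter]
    have e3 : ∀ w, (Finset.univ.filter fun b => T'.val (t.fibre h w b) ≤ o + j).card =
        (if w < v then a w else 0) +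
          if w = v then (Finset.univ.filter fun b => s'.val b ≤ j).card else 0 := by
      intro w
      rcases lt_trichotomy w v with hw | rfl | hw
      · rw [if_pos hw, if_neg hw.ne, Finset.filter_true_of_mem]
        · simp
        · intro b _
          have := hlt w hw b
          omega
      · rw [if_neg (lt_irrefl _), if_pos rfl, zero_add]
        congr 1
        ext b
        simp only [Finset.mem_filter, Finset.mem_univ, true_and, hv]
        omega
      · rw [if_neg hw.not_gt, if_neg hw.ne', Finset.filter_false_of_mem]
        · simp
        · intro b _
          have := hgt w hw b
          omega
    simp_rw [e3, Finset.sum_add_distrib]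
    simp
  have hfib : ∀ i, (T'.val i = o + j ∨ T'.val i = o + j + 1) → t.toFun i = v := by
    rw [t.forall_fibre h]
    intro w b hb
    rw [toFun_fibre]
    rcases lt_trichotomy w v with hw | rfl | hw
    · have := hlt w hw b
      omega
    · rfl
    · have := hgt w hw b
      omega
  have e2 : (Finset.univ.filter fun p : Fin n × Fin n =>
        p.1 < p.2 ∧ T'.val p.1 = o + j + 1 ∧ T'.val p.2 = o + j).card =
      (Finset.univ.filter fun p : Fin (a v) × Fin (a v) =>
        p.1 < p.2 ∧ s'.val p.1 = j + 1 ∧ s'.val p.2 = j).card := by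
    symm
    refine Finset.card_bij (fun p _ => (t.fibre h v p.1, t.fibre h v p.2)) ?_ ?_ ?_
    · rintro ⟨b, c⟩ hp
      simp only [Finset.mem_filter, Finset.mem_univ, true_and, fibre_lt_iff, hv] at hp ⊢
      exact ⟨hp.1, by omega, by omega⟩
    · rintro ⟨b, c⟩ _ ⟨b', c'⟩ _ hp
      simp only [Prod.mk.injEq] at hp
      rw [t.fibre_injective h v hp.1, t.fibre_injective h v hp.2]
    · rintro ⟨x, y⟩ hp
      simp only [Finset.mem_filter, Finset.mem_univ, true_and] at hp
      obtain ⟨b, rfl⟩ := t.exists_fibre_eq h (hfib x (Or.inr hp.2.1))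
      obtain ⟨c, rfl⟩ := t.exists_fibre_eq h (hfib y (Or.inl hp.2.2))
      refine ⟨(b, c), ?_, rfl⟩
      simp only [Finset.mem_filter, Finset.mem_univ, true_and, fibre_lt_iff, hv] at hp ⊢
      exact ⟨hp.1, by omega, by omega⟩
  rw [cutExp, cutExp, e1, e2]
  omega

end update

end Surj

namespace Surj

variable {n : ℕ} (t : Surj n) {a : Fin t.size → ℕ} (h : t.HasType a) (s : ∀ j, Surj (a j))

theorem sum_range_sum {k : ℕ} (f : Fin k → ℕ) {M : Type*} [AddCommMonoid M] (g : ℕ → M) :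
    ∑ J ∈ Finset.range (∑ v, f v), g J =
      ∑ v, ∑ j ∈ Finset.range (f v), g (∑ u ∈ Finset.univ.filter (· < v), f u + j) := by
  simp_rw [Finset.sum_range]
  rw [← finSigmaFinEquiv.sum_comp, Fintype.sum_sigma]
  simp_rw [finSigma_val]

/-- Source of the Leibniz sign: earlier pieces contribute their inputs through `cutExp` and their
vertices through the shift of `j`. Modulo two, the total is the sum of their degrees `a w - (s
w).size`. -/
theorem Covers.sign_subst_update {v : Fin t.size} {j : ℕ} {s' : Surj (a v)}
    (hc : Covers j s' (s v)) :
    (t.subst a h s).κ * (t.subst a h (Function.update s v s')).κ *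
        (-1) ^ (∑ u ∈ Finset.univ.filter (· < v), (s u).size + j) =
      (∑ w ∈ Finset.univ.filter (· < v), ((a w : ℤ) - (s w).size)).negOnePow *
        ((s v).κ * s'.κ * (-1) ^ j) := by
  rw [(Covers.subst_update t h s hc).κ_mul_κ, hc.κ_mul_κ, cutExp_subst_update t h s hc,
    Finset.sum_sub_distrib, Int.negOnePow_sub]
  rw [← Nat.cast_sum, ← Nat.cast_sum, Units.val_mul, Int.coe_negOnePow_natCast,
    Int.coe_negOnePow_natCast]
  ring

open Classical in
theorem sum_covers_subst {K : Type u} [CommRing K] (v : Fin t.size) {j : ℕ}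
    (hj : j < (s v).size) :
    (∑ T', (if Covers (∑ u ∈ Finset.univ.filter (· < v), (s u).size + j) T' (t.subst a h s) then
      (t.subst a h s).κ * T'.κ * (-1) ^ (∑ u ∈ Finset.univ.filter (· < v), (s u).size + j)
        else 0) • Finsupp.single T' (1 : K)) =
    ((∑ w ∈ Finset.univ.filter (· < v), ((a w : ℤ) - (s w).size)).negOnePow : ℤ) •
      ∑ s', (if Covers j s' (s v) then (s v).κ * s'.κ * (-1) ^ j else 0) •
        Finsupp.single (t.subst a h (Function.update s v s')) (1 : K) := by
  simp_rw [ite_smul, zero_smul]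
  rw [← Finset.sum_filter, ← Finset.sum_filter, Finset.smul_sum]
  symm
  refine Finset.sum_bij (fun s' _ => t.subst a h (Function.update s v s')) ?_ ?_ ?_ ?_
  · intro s' hs'
    simp only [Finset.mem_filter, Finset.mem_univ, true_and] at hs' ⊢
    exact Covers.subst_update t h s hs'
  · intro s' _ s'' _ hss
    exact Function.update_injective s v (t.subst_injective h hss)
  · intro T' hT'
    simp only [Finset.mem_filter, Finset.mem_univ, true_and] at hT'
    obtain ⟨s', hs', hT⟩ := exists_covers_of_covers_subst t h s hj hT'
    exact ⟨s', by simpa using hs', hT⟩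
  · intro s' hs'
    simp only [Finset.mem_filter, Finset.mem_univ, true_and] at hs'
    rw [Covers.sign_subst_update t h s hs', smul_smul]

end Surj

/-! ### The differential is a derivation of square zero. -/

section PermBdry

variable (K : Type u) [CommRing K]

/-- The boundary map of `permAs_∞`. -/
def permBdry (n : ℕ) : (Surj n →₀ K) →ₗ[K] (Surj n →₀ K) :=
  Finsupp.linearCombination K fun T => ∑ T', Surj.bdryCoeff T' T • Finsupp.single T' (1 : K)

theorem permBdry_single {n : ℕ} (T : Surj n) :
    permBdry K n (Finsupp.single T 1) =
      ∑ T', Surj.bdryCoeff T' T • Finsupp.single T' (1 : K) := by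
  rw [permBdry, Finsupp.linearCombination_single, one_smul]

theorem surjΓ_update_permBdry {n : ℕ} (t : Surj n) (a : Fin t.size → ℕ) (h : t.HasType a)
    (s : ∀ j, Surj (a j)) (v : Fin t.size) :
    surjΓ K t a h (Function.update (fun w => Finsupp.single (s w) (1 : K)) v
      (permBdry K (a v) (Finsupp.single (s v) 1))) =
    ∑ s', Surj.bdryCoeff s' (s v) •
      Finsupp.single (t.subst a h (Function.update s v s')) (1 : K) := by
  change (surjΓ K t a h).toLinearMap (fun w => Finsupp.single (s w) (1 : K)) v _ = _
  rw [permBdry_single, map_sum]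
  refine Finset.sum_congr rfl fun s' _ => ?_
  rw [map_zsmul, MultilinearMap.toLinearMap_apply, ← surjΓ_single]
  congr 2
  funext w
  rcases eq_or_ne w v with rfl | hw
  · simp
  · simp [hw]

theorem permBdry_single_subst {n : ℕ} (t : Surj n) (a : Fin t.size → ℕ) (h : t.HasType a)
    (s : ∀ j, Surj (a j)) :
    permBdry K n (Finsupp.single (t.subst a h s) 1) =
      ∑ v, ((∑ w ∈ Finset.univ.filter (· < v), ((a w : ℤ) - (s w).size)).negOnePow : ℤ) •
        surjΓ K t a h (Function.update (fun w => Finsupp.single (s w) (1 : K)) v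
          (permBdry K (a v) (Finsupp.single (s v) 1))) := by
  classical
  simp_rw [surjΓ_update_permBdry, permBdry_single, Surj.bdryCoeff]
  rw [Surj.subst_size]
  simp_rw [Surj.sum_range_sum, Finset.sum_smul]
  rw [Finset.sum_comm]
  refine Finset.sum_congr rfl fun v _ => ?_
  rw [Finset.sum_comm, Finset.sum_comm (s := Finset.univ) (t := Finset.range _), Finset.smul_sum]
  refine Finset.sum_congr rfl fun j hj => ?_
  exact Surj.sum_covers_subst t h s v (Finset.mem_range.1 hj)

/-- A multilinear map on free modules is determined by its values on the bases. -/
theorem multilinearMap_apply_eq_sum_single {ι : Type*} [Fintype ι] [DecidableEq ι]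
    {S : ι → Type*} [∀ v, Fintype (S v)] {M : Type*} [AddCommGroup M] [Module K M]
    (f : MultilinearMap K (fun v => S v →₀ K) M) (x : ∀ v, S v →₀ K) :
    f x = ∑ s : ∀ v, S v, (∏ v, x v (s v)) • f fun v => Finsupp.single (s v) 1 := by
  classical
  have hx : x = fun v => ∑ s, x v s • Finsupp.single s (1 : K) := by
    funext v
    simp only [Finsupp.smul_single, smul_eq_mul, mul_one]
    exact (Finsupp.univ_sum_single (x v)).symm
  conv_lhs => rw [hx]
  rw [MultilinearMap.map_sum]
  refine Finset.sum_congr rfl fun s _ => ?_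
  rw [MultilinearMap.map_smul_univ]

theorem permBdry_leibniz {n : ℕ} (t : Surj n) (a : Fin t.size → ℕ) (h : t.HasType a)
    (e : Fin t.size → ℤ) (x : ∀ v, Surj (a v) →₀ K) (hx : ∀ v, x v ∈ surjDeg K (a v) (e v)) :
    permBdry K n (surjΓ K t a h x) =
      ∑ v, ((∑ w ∈ Finset.univ.filter (· < v), e w).negOnePow : ℤ) •
        surjΓ K t a h (Function.update x v (permBdry K (a v) (x v))) := by
  classical
  -- Writing the update as a family of linear maps, the identity away from `v`, makes the term
  -- multilinear in `x`, so that it can be expanded on bases.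
  let g : ∀ v w, (Surj (a w) →₀ K) →ₗ[K] (Surj (a w) →₀ K) := fun v w =>
    if w = v then permBdry K (a w) else LinearMap.id
  have hg : ∀ (y : ∀ v, Surj (a v) →₀ K) v, Function.update y v (permBdry K (a v) (y v)) =
      fun w => g v w (y w) := by
    intro y v
    funext w
    rcases eq_or_ne w v with rfl | hw
    · simp [g]
    · simp [g, hw]
  have hG : ∀ v, surjΓ K t a h (Function.update x v (permBdry K (a v) (x v))) =
      ∑ s : ∀ v, Surj (a v), (∏ v, x v (s v)) •
        surjΓ K t a h (Function.update (fun w => Finsupp.single (s w) (1 : K)) v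
          (permBdry K (a v) (Finsupp.single (s v) 1))) := by
    intro v
    rw [hg]
    change (surjΓ K t a h).compLinearMap (g v) x = _
    rw [multilinearMap_apply_eq_sum_single]
    refine Finset.sum_congr rfl fun s _ => ?_
    rw [hg]
    rfl
  simp_rw [hG]
  rw [surjΓ_apply, map_sum]
  simp_rw [Finset.smul_sum]
  rw [Finset.sum_comm]
  refine Finset.sum_congr rfl fun s _ => ?_
  rw [map_smul]
  -- A basis term with nonzero coefficient has every `s v` in the support of `x v`, hence of degree
  -- `e v`; the signs then agree with those on basis elements.
  by_cases hs : ∏ v, x v (s v) = 0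
  · simp [hs]
  · have he : ∀ v, e v = (a v : ℤ) - (s v).size := fun v =>
      (hx v (Finsupp.mem_support_iff.2 fun h0 => hs (Finset.prod_eq_zero (Finset.mem_univ v) h0))).symm
    rw [permBdry_single_subst, Finset.smul_sum]
    refine Finset.sum_congr rfl fun v _ => ?_
    simp_rw [he]
    rw [smul_comm]

theorem permBdry_mem_deg (n : ℕ) (i : ℤ) (x : Surj n →₀ K) (hx : x ∈ surjDeg K n i) :
    permBdry K n x ∈ surjDeg K n (i - 1) := by
  rw [permBdry, Finsupp.linearCombination_apply]
  refine Submodule.sum_mem _ fun T hT => Submodule.smul_mem _ _ (Submodule.sum_mem _ fun T' _ => ?_)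
  by_cases h0 : Surj.bdryCoeff T' T = 0
  · rw [h0, zero_smul]
    exact Submodule.zero_mem _
  · refine zsmul_mem (Finsupp.single_mem_supported K _ ?_) _
    have h1 := Surj.size_eq_of_bdryCoeff_ne_zero h0
    have h2 : (n : ℤ) - T.size = i := hx hT
    change (n : ℤ) - T'.size = i - 1
    omega

theorem permBdry_permBdry (n : ℕ) (x : Surj n →₀ K) : permBdry K n (permBdry K n x) = 0 := by
  suffices h : permBdry K n ∘ₗ permBdry K n = 0 from LinearMap.congr_fun h x
  refine Finsupp.lhom_ext' fun T => LinearMap.ext_ring ?_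
  simp only [LinearMap.comp_apply, Finsupp.lsingle_apply, LinearMap.zero_apply]
  rw [permBdry_single, map_sum]
  simp_rw [map_zsmul, permBdry_single, Finset.smul_sum, smul_smul]
  rw [Finset.sum_comm]
  refine Finset.sum_eq_zero fun T'' _ => ?_
  rw [← Finset.sum_smul]
  simp_rw [mul_comm]
  rw [Surj.sum_bdryCoeff_mul, zero_smul]

end PermBdry

/-! ### Shuffle signs and decorations by corollas. -/

theorem Tuple.sign_sort {n : ℕ} {α : Type*} [LinearOrder α] (f : Fin n → α) :
    (Equiv.Perm.sign (Tuple.sort f) : ℤ) =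
      (-1) ^ (Finset.univ.filter fun p : Fin n × Fin n => p.1 < p.2 ∧ f p.2 < f p.1).card := by
  obtain ⟨hm, hs⟩ := Tuple.eq_sort_iff.1 (rfl : Tuple.sort f = Tuple.sort f)
  set σ := Tuple.sort f
  have h1 : (Equiv.Perm.sign σ : ℤ) = ∏ p : Fin n × Fin n,
      if p.1 < p.2 ∧ σ p.2 < σ p.1 then -1 else 1 := by
    rw [Equiv.Perm.sign_eq_prod_prod_Iio, Fintype.prod_prod_type_right, Units.coe_prod]
    refine Finset.prod_congr rfl fun j _ => ?_
    rw [Units.coe_prod]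
    rw [← Finset.prod_subset (Finset.subset_univ (Finset.Iio j))]
    · refine Finset.prod_congr rfl fun i hi => ?_
      have hi := Finset.mem_Iio.1 hi
      have := σ.injective.ne hi.ne
      rcases lt_or_gt_of_ne this with hl | hl
      · simp [hl, hl.not_gt]
      · simp [hl, hl.not_gt, hi]
    · intro i _ hi
      exact if_neg fun h => hi (Finset.mem_Iio.2 h.1)
  rw [h1, Finset.prod_ite, Finset.prod_const, Finset.prod_const_one, mul_one]
  congr 1
  -- Since `f ∘ σ` is monotone and the sort is stable, so that ties are never inverted, the
  -- inversions of `σ` become exactly the inversions of `f`.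
  refine Finset.card_bij (fun p _ => (σ p.2, σ p.1)) ?_ ?_ ?_
  · rintro ⟨i, j⟩ hp
    simp only [Finset.mem_filter, Finset.mem_univ, true_and] at hp ⊢
    refine ⟨hp.2, lt_of_le_of_ne (hm hp.1.le) fun he => ?_⟩
    exact (hs i j hp.1 he).not_gt hp.2
  · rintro ⟨i, j⟩ _ ⟨i', j'⟩ _ hp
    simpa [and_comm] using hp
  · rintro ⟨x, y⟩ hp
    simp only [Finset.mem_filter, Finset.mem_univ, true_and] at hp
    refine ⟨(σ.symm y, σ.symm x), ?_, by simp⟩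
    simp only [Finset.mem_filter, Finset.mem_univ, true_and, Equiv.apply_symm_apply]
    refine ⟨lt_of_not_ge fun hle => ?_, hp.1⟩
    have := hm hle
    simp only [Function.comp_apply, Equiv.apply_symm_apply] at this
    exact this.not_gt hp.2

namespace Surj

theorem corolla_val (n : ℕ) (i : Fin (n + 1)) : (corolla n).val i = 0 := rfl

theorem κ_corolla (n : ℕ) : (corolla n).κ = 1 := by
  have h1 : (corolla n).signExp = 0 := by
    simp only [signExp, corolla_val, lt_irrefl, and_false]
    simp [corolla]
  rw [κ, h1, pow_zero]

theorem covers_corolla_iff {n J : ℕ} {T' : Surj (n + 1)} :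
    Covers J T' (corolla n) ↔ J = 0 ∧ T'.size = 2 := by
  constructor
  · rintro ⟨h1, h2, -⟩
    change J < 1 at h2
    exact ⟨by omega, h1⟩
  · rintro ⟨rfl, h⟩
    refine ⟨h, Nat.one_pos, fun i => ?_⟩
    have := T'.val_lt i
    rw [corolla_val]
    split_ifs <;> omega

/-- With two vertices the only proper initial segment is the first vertex, so the second summand of
`signExp` counts the fibre over `0`; the first summand gives the sign of the shuffle by
`Tuple.sign_sort`. -/
theorem κ_of_size_two {n : ℕ} (f : Fin n → Fin 2) (hf : Function.Surjective f) :
    (⟨2, f, hf⟩ : Surj n).κ = sgn f := by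
  rw [κ, signExp, pow_add, sgn, Tuple.sign_sort, Finset.card_filter (fun i => f i = 0)]
  congr 2
  refine Finset.sum_congr rfl fun i _ => ?_
  change 2 - 1 - (f i : ℕ) = _
  generalize f i = v
  fin_cases v <;> rfl

/-- The surjective map onto a set with at most one element. -/
def cor : ∀ m, Surj m
  | 0 => empty
  | m + 1 => corolla m

theorem cor_val (m : ℕ) (i : Fin m) : (cor m).val i = 0 := by
  cases m with
  | zero => exact i.elim0
  | succ m => rfl

theorem cor_size {m : ℕ} (hm : 0 < m) : (cor m).size = 1 := by
  cases m with
  | zero => exact absurd hm (lt_irrefl _)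
  | succ m => rfl

theorem HasType.pos {n : ℕ} {t : Surj n} {a : Fin t.size → ℕ} (h : t.HasType a)
    (v : Fin t.size) : 0 < a v := by
  obtain ⟨i, rfl⟩ := t.surjective v
  exact (Nat.zero_le _).trans_lt (t.pos_lt h i)

/-- Corollas generate: this underlies both uniqueness of the derivation and freeness. Fibres are
nonempty, so the vertexless value `cor 0` never occurs here. -/
theorem subst_cor {n : ℕ} (t : Surj n) (a : Fin t.size → ℕ) (h : t.HasType a) :
    t.subst a h (fun v => cor (a v)) = t := by
  refine ext_val fun i => ?_
  rw [subst_val, cor_val, Finset.sum_congr rfl fun u _ => cor_size (h.pos u)]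
  simp only [Finset.sum_const, smul_eq_mul, mul_one, add_zero]
  have : (Finset.univ.filter fun u => u < t.toFun i) = Finset.Iio (t.toFun i) := by ext; simp
  rw [this, Fin.card_Iio]
  rfl

/-- The numbers of inputs of the vertices. -/
def type {n : ℕ} (t : Surj n) (v : Fin t.size) : ℕ :=
  (Finset.univ.filter fun i => t.toFun i = v).card

theorem hasType_type {n : ℕ} (t : Surj n) : t.HasType t.type := fun _ => rfl

theorem HasType.eq_type {n : ℕ} {t : Surj n} {a : Fin t.size → ℕ} (h : t.HasType a) :
    a = t.type := funext fun v => (h v).symm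

end Surj

/-! ### Value on the generators, uniqueness of the derivation, freeness. -/

section

variable (K : Type u) [CommRing K]

theorem permBdry_corolla (n : ℕ) :
    permBdry K (n + 1) (Finsupp.single (Surj.corolla n) 1) = bigCellBoundary K n := by
  classical
  rw [permBdry_single]
  symm
  refine Fintype.sum_of_injective
    (fun t : {f : Fin (n + 1) → Fin 2 // Function.Surjective f} => (⟨2, t.1, t.2⟩ : Surj (n + 1)))
    ?_ _ _ ?_ ?_
  · rintro ⟨f, hf⟩ ⟨g, hg⟩ hfg
    simpa using hfg
  · intro T' hT'
    have h0 : Surj.bdryCoeff T' (Surj.corolla n) = 0 := by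
      refine Surj.bdryCoeff_eq_zero fun J hJ => ?_
      obtain ⟨k, f, hf⟩ := T'
      obtain rfl : k = 2 := (Surj.covers_corolla_iff.1 hJ).2
      exact hT' ⟨⟨f, hf⟩, rfl⟩
    rw [h0]
    exact zero_smul ℤ _
  · rintro ⟨f, hf⟩
    rw [(Surj.covers_corolla_iff.2 ⟨rfl, rfl⟩ :
      Surj.Covers 0 ⟨2, f, hf⟩ (Surj.corolla n)).bdryCoeff_eq, Surj.κ_corolla, Surj.κ_of_size_two]
    simp

theorem surjΓ_cor {n : ℕ} (t : Surj n) (a : Fin t.size → ℕ) (h : t.HasType a) :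
    surjΓ K t a h (fun v => Finsupp.single (Surj.cor (a v)) 1) = Finsupp.single t 1 := by
  rw [surjΓ_single, Surj.subst_cor]

theorem single_cor_mem_deg {m : ℕ} (hm : 0 < m) :
    (Finsupp.single (Surj.cor m) 1 : Surj m →₀ K) ∈ surjDeg K m (m - 1) := by
  refine Finsupp.single_mem_supported K _ ?_
  change (m : ℤ) - (Surj.cor m).size = m - 1
  rw [Surj.cor_size hm]
  rfl

theorem isDerivation_permBdry : (permAsInf K).IsDerivation (permBdry K) where
  mem_deg n i x hx := permBdry_mem_deg K n i x hx
  leibniz t a h e x hx := permBdry_leibniz K t a h e x hx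

theorem isDerivation_unique {d d' : ∀ n, (permAsInf K).op n →ₗ[K] (permAsInf K).op n}
    (hd : (permAsInf K).IsDerivation d) (hd' : (permAsInf K).IsDerivation d')
    (hg : ∀ n, d (n + 1) (gen K n) = d' (n + 1) (gen K n)) : d = d' := by
  have hcor : ∀ m, 0 < m → d m (Finsupp.single (Surj.cor m) (1 : K) : Surj m →₀ K) =
      d' m (Finsupp.single (Surj.cor m) (1 : K) : Surj m →₀ K) := by
    intro m hm
    cases m with
    | zero => exact absurd hm (lt_irrefl _)
    | succ m => exact hg m
  funext n
  refine Finsupp.lhom_ext' fun t => LinearMap.ext_ring ?_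
  change d n (Finsupp.single t (1 : K) : Surj n →₀ K) = d' n (Finsupp.single t (1 : K) : Surj n →₀ K)
  have h := t.hasType_type
  rw [← surjΓ_cor K t _ h]
  have hx : ∀ v, (Finsupp.single (Surj.cor (t.type v)) 1 : Surj (t.type v) →₀ K) ∈
      surjDeg K (t.type v) (t.type v - 1) := fun v => single_cor_mem_deg K (h.pos v)
  refine (hd.leibniz t _ h _ _ hx).trans (Eq.trans ?_ (hd'.leibniz t _ h _ _ hx).symm)
  refine Finset.sum_congr rfl fun v _ => ?_
  rw [hcor _ (h.pos v)]

namespace GradedPermutad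

variable {K} (Q : GradedPermutad.{u, w} K) (q : ∀ n : ℕ, Q.op (n + 1))

/-- A family of operations, extended by zero to arity one. -/
def extendGen : ∀ m, Q.op m
  | 0 => 0
  | m + 1 => q m

theorem extendGen_mem_deg (hq : ∀ n, q n ∈ Q.deg (n + 1) n) {m : ℕ} (hm : 0 < m) :
    Q.extendGen q m ∈ Q.deg m (m - 1) := by
  cases m with
  | zero => exact absurd hm (lt_irrefl _)
  | succ m => simpa using! hq m

/-- The linear map underlying the morphism from `permAs_∞` with given values on the generators. -/
def liftLin (n : ℕ) : (Surj n →₀ K) →ₗ[K] Q.op n :=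
  Finsupp.linearCombination K fun t =>
    Q.Γ t t.type t.hasType_type fun v => Q.extendGen q (t.type v)

theorem liftLin_single {n : ℕ} (t : Surj n) (a : Fin t.size → ℕ) (h : t.HasType a) :
    Q.liftLin q n (Finsupp.single t 1) = Q.Γ t a h fun v => Q.extendGen q (a v) := by
  obtain rfl := h.eq_type
  rw [liftLin, Finsupp.linearCombination_single, one_smul]

theorem liftLin_surjΓ {n : ℕ} (t : Surj n) (a : Fin t.size → ℕ) (h : t.HasType a)
    (x : ∀ v, Surj (a v) →₀ K) :
    Q.liftLin q n (surjΓ K t a h x) = Q.Γ t a h fun v => Q.liftLin q (a v) (x v) := by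
  change _ = (Q.Γ t a h).compLinearMap (fun v => Q.liftLin q (a v)) x
  rw [multilinearMap_apply_eq_sum_single K ((Q.Γ t a h).compLinearMap _), surjΓ_apply, map_sum]
  refine Finset.sum_congr rfl fun s _ => ?_
  rw [map_smul, MultilinearMap.compLinearMap_apply]
  congr 1
  -- The type of the composite is taken in the form `substType`, the one in which `Γ_subst` is
  -- stated, which avoids a transport.
  rw [liftLin_single Q q _ _ (t.subst_hasType a h s (fun j => (s j).type)
    fun j => (s j).hasType_type)]
  simp_rw [fun v => liftLin_single Q q (s v) _ (s v).hasType_type]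
  exact Q.Γ_subst t a h s (fun j => (s j).type) (fun j => (s j).hasType_type)
    fun j v => Q.extendGen q ((s j).type v)

theorem liftLin_mem_deg (hq : ∀ n, q n ∈ Q.deg (n + 1) n) (n : ℕ) (i : ℤ) (x : Surj n →₀ K)
    (hx : x ∈ surjDeg K n i) : Q.liftLin q n x ∈ Q.deg n i := by
  rw [liftLin, Finsupp.linearCombination_apply]
  refine Submodule.sum_mem _ fun t ht => Submodule.smul_mem _ _ ?_
  have h1 : (n : ℤ) - t.size = i := hx ht
  have h2 : ∑ v, ((t.type v : ℤ) - 1) = i := by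
    rw [← h1, Finset.sum_sub_distrib, ← Nat.cast_sum, t.sum_type t.hasType_type]
    simp
  rw [← h2]
  exact Q.Γ_mem_deg t _ _ _ _ fun v => Q.extendGen_mem_deg q hq (t.hasType_type.pos v)

end GradedPermutad

theorem isFreeOn_permAsInf :
    GradedPermutad.IsFreeOn.{u, u, w, 0} (permAsInf K) (fun n : ℕ => n + 1) (fun n => (n : ℤ))
      (gen K) := by
  refine ⟨fun n => ?_, fun Q q hq => ?_⟩
  · have := single_cor_mem_deg K n.succ_pos
    rw [Nat.cast_succ, add_sub_cancel_right] at this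
    exact this
  refine ⟨⟨Q.liftLin q, Q.liftLin_mem_deg q hq, Q.liftLin_surjΓ q⟩, fun n => ?_, ?_⟩
  · refine (Q.liftLin_single q (Surj.corolla n) _ (Surj.corolla_hasType n)).trans ?_
    exact Q.Γ_corolla n (q n)
  · intro f hf
    have hcor : ∀ m, 0 < m → f.toLin m (Finsupp.single (Surj.cor m) (1 : K) : Surj m →₀ K) =
        Q.extendGen q m := by
      intro m hm
      cases m with
      | zero => exact absurd hm (lt_irrefl _)
      | succ m => exact hf m
    have : f.toLin = Q.liftLin q := by
      funext n
      refine Finsupp.lhom_ext' fun t => LinearMap.ext_ring ?_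
      change f.toLin n (Finsupp.single t (1 : K) : Surj n →₀ K) =
        Q.liftLin q n (Finsupp.single t (1 : K) : Surj n →₀ K)
      have h := t.hasType_type
      rw [Q.liftLin_single q t _ h, ← surjΓ_cor K t _ h]
      refine (f.map_Γ t _ h _).trans ?_
      congr 1
      funext v
      exact hcor _ (h.pos v)
    obtain ⟨_, _, _⟩ := f
    simp only at this
    subst this
    rfl

end

/-! ### Faces of the permutohedron. -/

theorem convexHull_inter_isMax {E : Type*} [AddCommGroup E] [Module ℝ E] (S : Set E)
    (l : E →ₗ[ℝ] ℝ) (M : ℝ) (hM : ∀ s ∈ S, l s ≤ M) (hne : ∃ s ∈ S, l s = M) :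
    {x ∈ convexHull ℝ S | ∀ y ∈ convexHull ℝ S, l y ≤ l x} = convexHull ℝ {s ∈ S | l s = M} := by
  have hle : ∀ y ∈ convexHull ℝ S, l y ≤ M := fun y hy =>
    convexHull_min (t := {y | l y ≤ M}) hM (convex_halfSpace_le l.isLinear M) hy
  apply Set.Subset.antisymm
  · rintro x ⟨hx, hmax⟩
    obtain ⟨s, hs, hsM⟩ := hne
    have hxM : l x = M := le_antisymm (hle x hx) (hsM ▸ hmax s (subset_convexHull ℝ S hs))
    obtain ⟨ι, _, w, z, hw, hw1, hz, rfl⟩ := mem_convexHull_iff_exists_fintype.1 hx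
    -- A convex combination attaining the maximum has weighted gaps that are nonnegative with sum
    -- zero, so every point of nonzero weight attains it too.
    have h0 : ∑ i, w i * (M - l (z i)) = 0 := by
      simp only [map_sum, map_smul, smul_eq_mul] at hxM
      simp_rw [mul_sub, Finset.sum_sub_distrib]
      rw [hxM, ← Finset.sum_mul, hw1, one_mul, sub_self]
    have h1 := (Finset.sum_eq_zero_iff_of_nonneg fun i _ =>
      mul_nonneg (hw i) (sub_nonneg.2 (hM _ (hz i)))).1 h0
    rw [← Finset.sum_filter_of_ne (p := fun i => w i ≠ 0) fun i _ h hi => h (by simp [hi])]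
    refine (convex_convexHull ℝ _).sum_mem (fun i _ => hw i) ?_ fun i hi => ?_
    · rw [Finset.sum_filter_of_ne (fun i _ h => h), hw1]
    · have h2 := (mul_eq_zero.1 (h1 i (Finset.mem_univ _))).resolve_left
        (Finset.mem_filter.1 hi).2
      exact subset_convexHull ℝ _ ⟨hz i, by linarith⟩
  · intro x hx
    refine ⟨convexHull_mono (fun s hs => hs.1) hx, fun y hy => ?_⟩
    have : l x = M := by
      refine convexHull_min (t := {y | l y = M}) (fun s hs => hs.2) ?_ hx
      exact convex_hyperplane l.isLinear M
    rw [this]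
    exact hle y hy

section Permutohedron

variable {N : ℕ}

/-- The vertex of the permutohedron given by a permutation. -/
def permPoint (σ : Equiv.Perm (Fin N)) (i : Fin N) : ℝ := ((σ i : ℕ) : ℝ) + 1

/-- The permutations which are increasing with respect to a given function. -/
def compat {α : Type*} [LT α] (c : Fin N → α) : Set (Equiv.Perm (Fin N)) :=
  {σ | ∀ i j, c i < c j → σ i < σ j}

/-- The linear functional with given coefficients. -/
def coordFunctional (c : Fin N → ℝ) : (Fin N → ℝ) →L[ℝ] ℝ :=
  ∑ i, c i • ContinuousLinearMap.proj i

theorem coordFunctional_apply (c x : Fin N → ℝ) : coordFunctional c x = ∑ i, c i * x i := by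
  simp [coordFunctional]

theorem exists_coordFunctional_eq (l : StrongDual ℝ (Fin N → ℝ)) :
    ∃ c, l = coordFunctional c := by
  refine ⟨fun i => l (Pi.single i 1), ?_⟩
  ext x
  rw [coordFunctional_apply, ← ContinuousLinearMap.coe_coe,
    LinearMap.pi_apply_eq_sum_univ (l : (Fin N → ℝ) →ₗ[ℝ] ℝ) x]
  refine Finset.sum_congr rfl fun i _ => ?_
  rw [smul_eq_mul, mul_comm]
  congr 2
  ext j
  simp [Pi.single_apply, eq_comm]

theorem compat_nonempty {α : Type*} [LinearOrder α] (c : Fin N → α) : (compat c).Nonempty := by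
  refine ⟨(Tuple.sort c).symm, fun i j hij => ?_⟩
  by_contra h
  have := Tuple.monotone_sort c (not_lt.1 h)
  simp only [Function.comp_apply, Equiv.apply_symm_apply] at this
  exact this.not_gt hij

theorem permPoint_lt_iff (σ : Equiv.Perm (Fin N)) (i j : Fin N) :
    permPoint σ i < permPoint σ j ↔ σ i < σ j := by
  simp [permPoint]

/-- This puts compatibility in the form required by the rearrangement inequality and its equality
case. -/
theorem mem_compat_iff_monovary (c : Fin N → ℝ) (σ : Equiv.Perm (Fin N)) :
    σ ∈ compat c ↔ Monovary c (permPoint σ) := by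
  constructor
  · intro h i j hij
    rw [permPoint_lt_iff] at hij
    exact not_lt.1 fun h' => lt_asymm hij (h _ _ h')
  · intro h i j hij
    by_contra h'
    have hne : i ≠ j := by
      rintro rfl
      exact lt_irrefl _ hij
    have := lt_of_le_of_ne (not_lt.1 h') (σ.injective.ne hne.symm)
    exact (h ((permPoint_lt_iff σ j i).2 this)).not_gt hij

theorem permPoint_comp (σ τ : Equiv.Perm (Fin N)) :
    permPoint τ = permPoint σ ∘ (σ.symm * τ : Equiv.Perm (Fin N)) := by
  funext i
  simp [permPoint]

theorem coordFunctional_permPoint_le (c : Fin N → ℝ) {σ : Equiv.Perm (Fin N)} (hσ : σ ∈ compat c)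
    (τ : Equiv.Perm (Fin N)) :
    coordFunctional c (permPoint τ) ≤ coordFunctional c (permPoint σ) := by
  rw [permPoint_comp σ τ, coordFunctional_apply, coordFunctional_apply]
  exact ((mem_compat_iff_monovary c σ).1 hσ).sum_mul_comp_perm_le_sum_mul

theorem coordFunctional_permPoint_eq_iff (c : Fin N → ℝ) {σ : Equiv.Perm (Fin N)}
    (hσ : σ ∈ compat c) (τ : Equiv.Perm (Fin N)) :
    coordFunctional c (permPoint τ) = coordFunctional c (permPoint σ) ↔ τ ∈ compat c := by
  rw [mem_compat_iff_monovary, permPoint_comp σ τ, coordFunctional_apply, coordFunctional_apply]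
  exact ((mem_compat_iff_monovary c σ).1 hσ).sum_mul_comp_perm_eq_sum_mul_iff

theorem permutohedronCell_eq {n : ℕ} (t : Surj (n + 1)) :
    permutohedronCell t = convexHull ℝ (permPoint '' compat t.toFun) := rfl

theorem permutohedronCell_nonempty {n : ℕ} (t : Surj (n + 1)) : (permutohedronCell t).Nonempty :=
  ((compat_nonempty t.toFun).image _).convexHull

/-- Only the order that `c` induces on the inputs matters. Taking `c` from `t` shows that cells are
faces; taking `t` from `c` shows that all faces are cells. -/
theorem setOf_isMax_coordFunctional {n : ℕ} (t : Surj (n + 1)) (c : Fin (n + 1) → ℝ)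
    (hc : ∀ i j, c i < c j ↔ t.toFun i < t.toFun j) :
    {x ∈ permutohedron n | ∀ y ∈ permutohedron n, coordFunctional c y ≤ coordFunctional c x} =
      permutohedronCell t := by
  have hcc : compat c = compat t.toFun := by
    ext σ
    simp only [compat, Set.mem_ofPred_eq, hc]
  obtain ⟨σ, hσ⟩ := compat_nonempty c
  refine (convexHull_inter_isMax _ (coordFunctional c : (Fin (n + 1) → ℝ) →ₗ[ℝ] ℝ)
    (coordFunctional c (permPoint σ)) ?_ ⟨_, Set.mem_range_self σ, rfl⟩).trans ?_
  · rintro _ ⟨τ, rfl⟩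
    exact coordFunctional_permPoint_le c hσ τ
  · rw [permutohedronCell_eq, ← hcc]
    congr 1
    ext x
    constructor
    · rintro ⟨⟨τ, rfl⟩, h⟩
      exact ⟨τ, (coordFunctional_permPoint_eq_iff c hσ τ).1 h, rfl⟩
    · rintro ⟨τ, hτ, rfl⟩
      exact ⟨⟨τ, rfl⟩, (coordFunctional_permPoint_eq_iff c hσ τ).2 hτ⟩

namespace Surj

/-- The surjective map with the same level sets, in the same order, as a given function. -/
def ofFun {α : Type*} [LinearOrder α] {n : ℕ} (c : Fin n → α) : Surj n where
  size := (Finset.univ.image c).card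
  toFun i := ((Finset.univ.image c).orderIsoOfFin rfl).symm
    ⟨c i, Finset.mem_image_of_mem c (Finset.mem_univ i)⟩
  surjective v := by
    obtain ⟨⟨y, hy⟩, rfl⟩ := ((Finset.univ.image c).orderIsoOfFin rfl).symm.surjective v
    obtain ⟨i, -, rfl⟩ := Finset.mem_image.1 hy
    exact ⟨i, rfl⟩

theorem ofFun_lt_iff {α : Type*} [LinearOrder α] {n : ℕ} (c : Fin n → α) (i j : Fin n) :
    (ofFun c).toFun i < (ofFun c).toFun j ↔ c i < c j :=
  ((Finset.univ.image c).orderIsoOfFin rfl).symm.lt_iff_lt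

end Surj

/-- The functional which is maximal on a given cell. -/
def cellFunctional {N : ℕ} (t : Surj N) : (Fin N → ℝ) →L[ℝ] ℝ :=
  coordFunctional fun i => (t.val i : ℝ)

theorem permutohedronCell_eq_setOf {n : ℕ} (t : Surj (n + 1)) :
    permutohedronCell t =
      {x ∈ permutohedron n | ∀ y ∈ permutohedron n, cellFunctional t y ≤ cellFunctional t x} :=
  (setOf_isMax_coordFunctional t _ fun i j => by
    rw [Nat.cast_lt, Fin.lt_def]
    rfl).symm

/-- The face which corresponds to a surjective map. -/
def cellFace {n : ℕ} (t : Surj (n + 1)) : Face (permutohedron n) where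
  carrier := permutohedronCell t
  nonempty := permutohedronCell_nonempty t
  isExposed := fun _ => ⟨_, permutohedronCell_eq_setOf t⟩

theorem lt_of_mem_permutohedronCell {n : ℕ} {t : Surj (n + 1)} {i j : Fin (n + 1)}
    (hij : t.toFun i < t.toFun j) {x : Fin (n + 1) → ℝ} (hx : x ∈ permutohedronCell t) :
    x i < x j := by
  refine convexHull_min (t := {x : Fin (n + 1) → ℝ | x i < x j}) ?_ ?_ hx
  · rintro _ ⟨σ, hσ, rfl⟩
    exact (permPoint_lt_iff σ i j).2 (hσ i j hij)
  · have := convex_halfSpace_lt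
      (f := fun x : Fin (n + 1) → ℝ => x i - x j)
      (LinearMap.proj (R := ℝ) (φ := fun _ : Fin (n + 1) => ℝ) i - LinearMap.proj j).isLinear 0
    simpa only [sub_neg] using this

theorem mul_swap_mem_compat {n : ℕ} {t : Surj n} {i j : Fin n} (hij : t.toFun i = t.toFun j)
    {σ : Equiv.Perm (Fin n)} (hσ : σ ∈ compat t.toFun) :
    σ * Equiv.swap i j ∈ compat t.toFun := by
  have h : ∀ l, t.toFun (Equiv.swap i j l) = t.toFun l := by
    intro l
    rw [Equiv.swap_apply_def]
    split_ifs with h1 h2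
    · rw [h1, hij]
    · rw [h2, hij]
    · rfl
  intro k l hkl
  rw [Equiv.Perm.mul_apply, Equiv.Perm.mul_apply]
  exact hσ _ _ (by rwa [h, h])

/-- The order of `t` can be read off its cell: for two inputs in one fibre, swapping them in a
vertex of the cell gives another vertex with the reversed inequality. -/
theorem lt_iff_forall_mem_permutohedronCell {n : ℕ} (t : Surj (n + 1)) (i j : Fin (n + 1)) :
    t.toFun i < t.toFun j ↔ ∀ x ∈ permutohedronCell t, x i < x j := by
  refine ⟨fun h x hx => lt_of_mem_permutohedronCell h hx, fun h => ?_⟩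
  obtain ⟨σ, hσ⟩ := compat_nonempty t.toFun
  have h1 := h _ (subset_convexHull ℝ _ ⟨σ, hσ, rfl⟩)
  rcases lt_trichotomy (t.toFun i) (t.toFun j) with hl | he | hl
  · exact hl
  · have h2 := h _ (subset_convexHull ℝ _ ⟨_, mul_swap_mem_compat he hσ, rfl⟩)
    simp only [Equiv.Perm.mul_apply, Equiv.swap_apply_left, Equiv.swap_apply_right] at h2
    exact absurd h1 h2.not_gt
  · exact absurd h1 ((permPoint_lt_iff σ j i).2 (hσ j i hl)).not_gt

theorem permutohedronCell_subset_iff {n : ℕ} {s t : Surj (n + 1)} :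
    permutohedronCell s ⊆ permutohedronCell t ↔
      ∀ i j, t.toFun i < t.toFun j → s.toFun i < s.toFun j := by
  constructor
  · intro h i j hij
    rw [lt_iff_forall_mem_permutohedronCell] at hij ⊢
    exact fun x hx => hij x (h hx)
  · intro h
    refine convexHull_mono (Set.image_mono fun σ hσ i j hij => hσ i j (h i j hij))

theorem cellFace_injective {n : ℕ} : Function.Injective (cellFace (n := n)) := by
  intro s t hst
  have h : permutohedronCell s = permutohedronCell t := congrArg Face.carrier hst
  refine Surj.ext_of_lt_iff fun i j => ⟨?_, ?_⟩
  · exact permutohedronCell_subset_iff.1 h.ge i j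
  · exact permutohedronCell_subset_iff.1 h.le i j

theorem cellFace_surjective {n : ℕ} : Function.Surjective (cellFace (n := n)) := by
  intro F
  obtain ⟨l, hl⟩ := F.isExposed F.nonempty
  obtain ⟨c, rfl⟩ := exists_coordFunctional_eq l
  refine ⟨Surj.ofFun c, Face.ext ?_⟩
  rw [hl]
  exact (setOf_isMax_coordFunctional _ c fun i j => (Surj.ofFun_lt_iff c i j).symm).symm

/-- The faces of the permutohedron correspond to the surjective maps. -/
def cellEquiv (n : ℕ) : Surj (n + 1) ≃ Face (permutohedron n) :=
  Equiv.ofBijective cellFace ⟨cellFace_injective, cellFace_surjective⟩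

/-! ### Directions and dimensions of the cells. -/

/-- The sums of the coordinates over the fibres. -/
def fibreSum {N : ℕ} (t : Surj N) : (Fin N → ℝ) →ₗ[ℝ] (Fin t.size → ℝ) :=
  LinearMap.pi fun v => ∑ i ∈ Finset.univ.filter (fun i => t.toFun i = v), LinearMap.proj i

theorem fibreSum_apply {N : ℕ} (t : Surj N) (x : Fin N → ℝ) (v : Fin t.size) :
    fibreSum t x v = ∑ i ∈ Finset.univ.filter (fun i => t.toFun i = v), x i := by
  simp [fibreSum]

theorem fibreSum_surjective {N : ℕ} (t : Surj N) : Function.Surjective (fibreSum t) := by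
  intro y
  obtain ⟨r, hr⟩ := t.surjective.hasRightInverse
  refine ⟨∑ v, y v • Pi.single (r v) 1, ?_⟩
  funext v
  rw [fibreSum_apply, Finset.sum_eq_single (r v)]
  · rw [Finset.sum_apply, Finset.sum_eq_single v]
    · simp
    · intro w _ hw
      have : r v ≠ r w := fun h => hw (by rw [← hr w, ← h, hr])
      simp [this]
    · simp
  · intro i hi hir
    rw [Finset.sum_apply]
    refine Finset.sum_eq_zero fun w _ => ?_
    have : i ≠ r w := by
      rintro rfl
      simp only [Finset.mem_filter, Finset.mem_univ, true_and, hr w] at hi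
      rw [hi] at hir
      exact hir rfl
    simp [this]
  · intro h
    exact absurd (by simp [hr v]) h

theorem finrank_ker_fibreSum {N : ℕ} (t : Surj N) :
    t.size + Module.finrank ℝ (LinearMap.ker (fibreSum t)) = N := by
  have h1 := LinearMap.finrank_range_add_finrank_ker (fibreSum t)
  rw [LinearMap.range_eq_top.2 (fibreSum_surjective t), finrank_top] at h1
  simpa using h1

theorem fibreSum_eq_of_mem_compat {N : ℕ} {t : Surj N} {σ τ : Equiv.Perm (Fin N)}
    (hσ : σ ∈ compat t.toFun) (hτ : τ ∈ compat t.toFun) :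
    fibreSum t (permPoint σ) = fibreSum t (permPoint τ) := by
  -- The indicator of `k ≤ t.val i` is weakly increasing along `t`, so every permutation compatible
  -- with `t` maximizes it, and all give the same value. Fibre sums are differences of two
  -- consecutive such functionals.
  have hc : ∀ k : ℕ, coordFunctional (fun i => if k ≤ t.val i then (1 : ℝ) else 0) (permPoint σ) =
      coordFunctional (fun i => if k ≤ t.val i then (1 : ℝ) else 0) (permPoint τ) := by
    intro k
    have hsub : ∀ ρ ∈ compat t.toFun, ρ ∈ compat fun i => if k ≤ t.val i then (1 : ℝ) else 0 := by
      intro ρ hρ i j hij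
      refine hρ i j ?_
      rw [Fin.lt_def]
      change t.val i < t.val j
      dsimp only at hij
      split_ifs at hij <;> first | omega | norm_num at hij
    exact (coordFunctional_permPoint_eq_iff _ (hsub τ hτ) σ).2 (hsub σ hσ)
  funext v
  have hv : ∀ x : Fin N → ℝ, fibreSum t x v =
      coordFunctional (fun i => if (v : ℕ) ≤ t.val i then (1 : ℝ) else 0) x -
      coordFunctional (fun i => if (v : ℕ) + 1 ≤ t.val i then (1 : ℝ) else 0) x := by
    intro x
    rw [fibreSum_apply, coordFunctional_apply, coordFunctional_apply, ← Finset.sum_sub_distrib,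
      Finset.sum_filter]
    refine Finset.sum_congr rfl fun i _ => ?_
    have : t.toFun i = v ↔ t.val i = v := Fin.ext_iff
    simp only [this]
    split_ifs <;> first | omega | simp
  rw [hv, hv, hc, hc]

theorem direction_cellFace {n : ℕ} (t : Surj (n + 1)) :
    (cellFace t).direction = LinearMap.ker (fibreSum t) := by
  apply le_antisymm
  · rw [Face.direction, vectorSpan_def, Submodule.span_le]
    rintro _ ⟨x, hx, y, hy, rfl⟩
    obtain ⟨σ, hσ⟩ := compat_nonempty t.toFun
    have h : ∀ z ∈ (cellFace t).carrier, fibreSum t z = fibreSum t (permPoint σ) := by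
      intro z hz
      refine convexHull_min (t := {z | fibreSum t z = fibreSum t (permPoint σ)}) ?_ ?_ hz
      · rintro _ ⟨τ, hτ, rfl⟩
        exact fibreSum_eq_of_mem_compat hτ hσ
      · exact (convex_singleton (fibreSum t (permPoint σ))).linear_preimage (fibreSum t)
    simp only [SetLike.mem_coe, LinearMap.mem_ker, vsub_eq_sub, map_sub]
    rw [h x hx, h y hy, sub_self]
  · have hmem : ∀ i j, t.toFun i = t.toFun j →
        (Pi.single i 1 - Pi.single j 1 : Fin (n + 1) → ℝ) ∈ (cellFace t).direction := by
      intro i j hij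
      rcases eq_or_ne i j with rfl | hne
      · rw [sub_self]
        exact Submodule.zero_mem _
      obtain ⟨σ, hσ⟩ := compat_nonempty t.toFun
      -- Swapping two inputs of a fibre stays in the cell and moves the vertex by a nonzero multiple
      -- of `e_i - e_j`.
      have h1 : permPoint σ -ᵥ permPoint (σ * Equiv.swap i j) ∈ (cellFace t).direction :=
        vsub_mem_vectorSpan ℝ (subset_convexHull ℝ _ ⟨σ, hσ, rfl⟩)
          (subset_convexHull ℝ _ ⟨_, mul_swap_mem_compat hij hσ, rfl⟩)
      have h2 : permPoint σ -ᵥ permPoint (σ * Equiv.swap i j) =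
          (((σ i : ℕ) : ℝ) - ((σ j : ℕ) : ℝ)) • (Pi.single i 1 - Pi.single j 1) := by
        funext l
        simp only [vsub_eq_sub, Pi.sub_apply, permPoint, Equiv.Perm.mul_apply, Pi.smul_apply,
          smul_eq_mul, Pi.single_apply, Equiv.swap_apply_def]
        by_cases hi : l = i
        · subst hi
          simp [hne]
        · by_cases hj : l = j
          · subst hj
            simp [hi]
          · simp [hi, hj]
      rw [h2] at h1
      refine (Submodule.smul_mem_iff _ ?_).1 h1
      rw [sub_ne_zero, Ne, Nat.cast_inj]
      exact fun h => hne (σ.injective (Fin.ext h))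
    intro x hx
    obtain ⟨r, hr⟩ := t.surjective.hasRightInverse
    -- The subtracted terms collect the fibre sums of `x` at the chosen representatives, and these
    -- sums vanish.
    have h3 : x = ∑ i, x i • (Pi.single i 1 - Pi.single (r (t.toFun i)) 1 : Fin (n + 1) → ℝ) := by
      have h4 : ∑ i, x i • (Pi.single (r (t.toFun i)) 1 : Fin (n + 1) → ℝ) = 0 := by
        rw [← Finset.sum_fiberwise Finset.univ t.toFun]
        refine Finset.sum_eq_zero fun v _ => ?_
        have h5 := congrFun (LinearMap.mem_ker.1 hx) v
        rw [fibreSum_apply, Pi.zero_apply] at h5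
        rw [Finset.sum_congr rfl (g := fun i => x i • (Pi.single (r v) 1 : Fin (n + 1) → ℝ)),
          ← Finset.sum_smul, h5, zero_smul]
        intro i hi
        rw [(Finset.mem_filter.1 hi).2]
      simp_rw [smul_sub, Finset.sum_sub_distrib]
      rw [h4, sub_zero]
      exact pi_eq_sum_univ' x
    rw [h3]
    exact Submodule.sum_mem _ fun i _ => Submodule.smul_mem _ _ (hmem _ _ (hr _).symm)

theorem size_add_dim {n : ℕ} (t : Surj (n + 1)) : t.size + (cellFace t).dim = n + 1 := by
  rw [Face.dim, direction_cellFace]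
  exact finrank_ker_fibreSum t

end Permutohedron

/-! ### Facets are splittings of one vertex. -/

namespace Surj

/-- A refinement induces a surjection from the vertices of `s` to those of `t`; equal cardinality
makes it bijective, so no vertex is split. -/
theorem eq_of_size_eq_of_lt {n : ℕ} {s t : Surj n} (hst : s.size = t.size)
    (h : ∀ i j, t.toFun i < t.toFun j → s.toFun i < s.toFun j) : s = t := by
  obtain ⟨r, hr⟩ := s.surjective.hasRightInverse
  have heq : ∀ i j, s.toFun i = s.toFun j → t.toFun i = t.toFun j := by
    intro i j hij
    rcases lt_trichotomy (t.toFun i) (t.toFun j) with hl | he | hl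
    · exact absurd hij (h _ _ hl).ne
    · exact he
    · exact absurd hij (h _ _ hl).ne'
  have hq : ∀ i, t.toFun (r (s.toFun i)) = t.toFun i := fun i => heq _ _ (hr _)
  have hbij : Function.Bijective fun v => t.toFun (r v) := by
    rw [Fintype.bijective_iff_surjective_and_card]
    refine ⟨fun w => ?_, by simp [hst]⟩
    obtain ⟨i, rfl⟩ := t.surjective w
    exact ⟨s.toFun i, hq i⟩
  refine ext_of_lt_iff fun i j => ⟨fun hij => ?_, h i j⟩
  by_contra hle
  rcases lt_or_eq_of_le (not_lt.1 hle) with hl | he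
  · exact lt_asymm hij (h _ _ hl)
  · refine hij.ne' (hbij.1 ?_)
    simp only [hq]
    exact he

theorem Covers.lt_of_lt {n J : ℕ} {s t : Surj n} (h : Covers J s t) (i j : Fin n)
    (hij : t.toFun i < t.toFun j) : s.toFun i < s.toFun j := by
  have h1 := h.2.2 i
  have h2 := h.2.2 j
  rw [Fin.lt_def] at hij ⊢
  change t.val i < t.val j at hij
  change s.val i < s.val j
  split_ifs at * <;> omega

/-- By the pigeonhole principle two vertices `v < w` of `s` lie over one vertex of `t`, and by
monotonicity so does everything between them. Hence `v` and `v + 1` can be merged, and the merge is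
`t` by a count of vertices. -/
theorem exists_covers {n : ℕ} {s t : Surj n} (hst : s.size = t.size + 1)
    (h : ∀ i j, t.toFun i < t.toFun j → s.toFun i < s.toFun j) : ∃ J, Covers J s t := by
  obtain ⟨r, hr⟩ := s.surjective.hasRightInverse
  have hle : ∀ i j, s.toFun i ≤ s.toFun j → t.toFun i ≤ t.toFun j := fun i j hij =>
    not_lt.1 fun hl => (h _ _ hl).not_ge hij
  obtain ⟨v, w, hvw, hq⟩ : ∃ v w, v < w ∧ t.toFun (r v) = t.toFun (r w) := by
    obtain ⟨v, w, hne, hq⟩ := Fintype.exists_ne_map_eq_of_card_lt (fun v => t.toFun (r v))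
      (by simp [hst])
    rcases lt_or_gt_of_ne hne with hl | hl
    · exact ⟨v, w, hl, hq⟩
    · exact ⟨w, v, hl, hq.symm⟩
  have hconst : ∀ i, v ≤ s.toFun i → s.toFun i ≤ w → t.toFun i = t.toFun (r v) := by
    intro i h1 h2
    refine le_antisymm ?_ (hle _ _ (by rwa [hr]))
    rw [hq]
    exact hle _ _ (by rwa [hr])
  have hv : (v : ℕ) + 1 < s.size := by
    have := w.2
    have : (v : ℕ) < w := hvw
    omega
  have hc := covers_merge v s hv
  refine ⟨v, ?_⟩
  have hm : merge v s hv = t := by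
    refine eq_of_size_eq_of_lt (by rw [merge_size]; omega) fun i j hij => ?_
    have h1 : s.val i < s.val j := h i j hij
    rw [Fin.lt_def]
    change (merge v s hv).val i < (merge v s hv).val j
    rw [merge_val, merge_val]
    have h2 : ¬ (s.val i = v ∧ s.val j = v + 1) := by
      rintro ⟨h3, h4⟩
      have h5 : (v : ℕ) < w := hvw
      have e1 := hconst i (Fin.le_def.2 (by change (v : ℕ) ≤ s.val i; omega))
        (Fin.le_def.2 (by change s.val i ≤ (w : ℕ); omega))
      have e2 := hconst j (Fin.le_def.2 (by change (v : ℕ) ≤ s.val j; omega))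
        (Fin.le_def.2 (by change s.val j ≤ (w : ℕ); omega))
      exact hij.ne (e1.trans e2.symm)
    split_ifs <;> omega
  rw [← hm]
  exact hc

end Surj

theorem cellFace_isFacet_iff {n : ℕ} {s t : Surj (n + 1)} :
    (cellFace s).IsFacet (cellFace t) ↔ ∃ J, Surj.Covers J s t := by
  have h1 := size_add_dim s
  have h2 := size_add_dim t
  constructor
  · rintro ⟨h3, h4⟩
    exact Surj.exists_covers (by omega) (permutohedronCell_subset_iff.1 h3)
  · rintro ⟨J, hJ⟩
    have := hJ.1
    exact ⟨permutohedronCell_subset_iff.2 hJ.lt_of_lt, by omega⟩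

/-! ### Determinants relative to the fibre indicators. -/

section SumDet

variable {M : Type*} [AddCommGroup M] [Module ℝ M] {ι κ : Type*}

/-- The alternating map obtained by fixing the right arguments. -/
def AlternatingMap.fixRight (f : M [⋀^ι ⊕ κ]→ₗ[ℝ] ℝ) (x : κ → M) : M [⋀^ι]→ₗ[ℝ] ℝ where
  toFun y := f (Sum.elim y x)
  map_update_add' y i a b := by
    classical
    simp only [← Sum.update_elim_inl,
      AlternatingMap.map_update_add]
  map_update_smul' y i c a := by
    classical
    simp only [← Sum.update_elim_inl,
      AlternatingMap.map_update_smul]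
  map_eq_zero_of_eq' y i j hij hne :=
    f.map_eq_zero_of_eq _ (i := Sum.inl i) (j := Sum.inl j) hij fun h => hne (Sum.inl_injective h)

/-- The alternating map obtained by fixing the left arguments. -/
def AlternatingMap.fixLeft (f : M [⋀^ι ⊕ κ]→ₗ[ℝ] ℝ) (y : ι → M) : M [⋀^κ]→ₗ[ℝ] ℝ where
  toFun x := f (Sum.elim y x)
  map_update_add' x i a b := by
    classical
    simp only [← Sum.update_elim_inr,
      AlternatingMap.map_update_add]
  map_update_smul' x i c a := by
    classical
    simp only [← Sum.update_elim_inr,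
      AlternatingMap.map_update_smul]
  map_eq_zero_of_eq' x i j hij hne :=
    f.map_eq_zero_of_eq _ (i := Sum.inr i) (j := Sum.inr j) hij fun h => hne (Sum.inr_injective h)

variable {N k d : ℕ}

/-- The determinant of a list of vectors of `ℝ^N` which is split into two parts. -/
def sumDet (h : k + d = N) : (Fin N → ℝ) [⋀^Fin k ⊕ Fin d]→ₗ[ℝ] ℝ :=
  (Pi.basisFun ℝ (Fin N)).det.domDomCongr (finSumFinEquiv.trans (finCongr h)).symm

theorem sumDet_elim (h : k + d = N) (y : Fin k → Fin N → ℝ) (x : Fin d → Fin N → ℝ) :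
    sumDet h (Sum.elim y x) =
      (Pi.basisFun ℝ (Fin N)).det fun i => Fin.append y x (Fin.cast h.symm i) := by
  subst h
  rw [sumDet, AlternatingMap.domDomCongr_apply]
  congr 1
  funext i
  refine Fin.addCases (fun j => ?_) (fun j => ?_) i
  · simp
  · simp

theorem sumDet_snoc (h : k + 1 + d = N) (h' : k + (d + 1) = N) (y : Fin k → Fin N → ℝ)
    (w : Fin N → ℝ) (x : Fin d → Fin N → ℝ) :
    sumDet h (Sum.elim (Fin.snoc y w : Fin (k + 1) → Fin N → ℝ) x) =
      sumDet h' (Sum.elim y (Fin.cons w x : Fin (d + 1) → Fin N → ℝ)) := by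
  rw [sumDet_elim, sumDet_elim, Fin.append_left_snoc]
  rfl

theorem sumDet_ne_zero (h : k + d = N) {v : Fin k ⊕ Fin d → Fin N → ℝ}
    (hv : LinearIndependent ℝ v) : sumDet h v ≠ 0 := by
  have h1 := hv.comp _ (finSumFinEquiv.trans (finCongr h)).symm.injective
  let b := basisOfLinearIndependentOfCardEqFinrank' _ h1 (by simp)
  have h2 := ((Pi.basisFun ℝ (Fin N)).isUnit_det b).ne_zero
  rw [coe_basisOfLinearIndependentOfCardEqFinrank'] at h2
  exact h2

end SumDet

/-- The indicator functions of the fibres. -/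
def fibreInd {N : ℕ} (t : Surj N) (v : Fin t.size) (i : Fin N) : ℝ :=
  if t.toFun i = v then 1 else 0

theorem fibreSum_sum_smul_fibreInd {N : ℕ} (t : Surj N) (g : Fin t.size → ℝ) (v : Fin t.size) :
    fibreSum t (∑ w, g w • fibreInd t w) v = t.type v * g v := by
  rw [fibreSum_apply, Surj.type, ← nsmul_eq_mul]
  refine Finset.sum_eq_card_nsmul fun i hi => ?_
  have hi := (Finset.mem_filter.1 hi).2
  rw [Finset.sum_apply, Finset.sum_eq_single v]
  · simp [fibreInd, hi]
  · intro w _ hw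
    simp [fibreInd, hi, hw.symm]
  · simp

theorem eq_zero_of_fibreSum_eq_zero {N : ℕ} (t : Surj N) (g : Fin t.size → ℝ)
    (h : fibreSum t (∑ w, g w • fibreInd t w) = 0) : g = 0 := by
  funext v
  have := congrFun h v
  rw [fibreSum_sum_smul_fibreInd] at this
  refine (mul_eq_zero.1 this).resolve_left ?_
  exact_mod_cast (t.hasType_type.pos v).ne'

/-- `fibreSum t` sends the indicators to nonzero multiples of the standard basis, so their span
meets its kernel trivially. -/
theorem linearIndependent_fibreInd_basis {N : ℕ} {t : Surj N} {D : Submodule ℝ (Fin N → ℝ)}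
    (hD : D = LinearMap.ker (fibreSum t)) {d : ℕ} (b : Module.Basis (Fin d) ℝ D) :
    LinearIndependent ℝ (Sum.elim (fibreInd t) fun i => (b i : Fin N → ℝ)) := by
  refine LinearIndependent.sum_type ?_ ?_ ?_
  · rw [Fintype.linearIndependent_iff]
    intro g hg
    exact congrFun (eq_zero_of_fibreSum_eq_zero t g (by rw [hg, map_zero]))
  · exact b.linearIndependent.map' D.subtype (Submodule.ker_subtype D)
  · rw [Submodule.disjoint_def]
    intro x hx hx'
    have hxD : x ∈ D := by
      refine (Submodule.span_le.2 ?_) hx'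
      rintro _ ⟨i, rfl⟩
      exact (b i).2
    obtain ⟨g, rfl⟩ := (Submodule.mem_span_range_iff_exists_fun ℝ).1 hx
    rw [hD] at hxD
    rw [eq_zero_of_fibreSum_eq_zero t g (LinearMap.mem_ker.1 hxD)]
    simp

theorem span_basis_subtype {M : Type*} [AddCommGroup M] [Module ℝ M] {D : Submodule ℝ M} {ι : Type*}
    (b : Module.Basis ι ℝ D) : Submodule.span ℝ (Set.range fun i => (b i : M)) = D := by
  have := congrArg (Submodule.map D.subtype) b.span_eq
  rw [Submodule.map_span, ← Set.range_comp, Submodule.map_subtype_top] at this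
  exact this

section Transition

variable {M : Type*} [AddCommGroup M] [Module ℝ M] {k : ℕ} (f : M [⋀^Fin (k + 1)]→ₗ[ℝ] ℝ)

theorem AlternatingMap.map_snoc (u : Fin k → M) (w : M) :
    f (Fin.snoc u w : Fin (k + 1) → M) = (-1) ^ k * f (Matrix.vecCons w u) := by
  rw [← Fin.insertNth_last', f.map_insertNth]
  simp

/-- Replacing a vector `a + b` by the two consecutive vectors `a` and `b`. -/
theorem AlternatingMap.map_vecCons_split (y : Fin (k + 1) → M) (u : Fin k → M) (J : Fin k)
    (hu : ∀ i, i ≠ J → u i = y (J.succ.succAbove i))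
    (hJ : u J = y J.castSucc + y J.succ) (α β : ℝ) :
    f (Matrix.vecCons (α • y J.castSucc + β • y J.succ) u) = (-1) ^ ((J : ℕ) + 1) * (β - α) * f y := by
  -- Putting `y J.castSucc + y J.succ` in front repeats the entry `u J`.
  have h0 : f (Matrix.vecCons (y J.castSucc) u) + f (Matrix.vecCons (y J.succ) u) = 0 := by
    rw [← f.map_vecCons_add, ← hJ]
    exact f.map_eq_zero_of_eq _ (i := 0) (j := J.succ) (by simp) (Fin.succ_ne_zero J).symm
  have h1 : u = Function.update (J.succ.removeNth y) J (y J.castSucc + y J.succ) := by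
    funext i
    rcases eq_or_ne i J with rfl | hi
    · rw [Function.update_self, hJ]
    · rw [Function.update_of_ne hi, hu i hi]
      rfl
  have h2 : Matrix.vecCons (y J.succ) u =
      Function.update (Matrix.vecCons (y J.succ) (J.succ.removeNth y)) J.succ
        (y J.castSucc + y J.succ) := by
    rw [h1]
    exact Fin.cons_update ..
  have h3 : Function.update (Matrix.vecCons (y J.succ) (J.succ.removeNth y)) J.succ
      (y J.castSucc) = Matrix.vecCons (y J.succ) (J.succ.removeNth y) := by
    rw [Function.update_eq_self_iff]
    simp [Fin.removeNth_apply, Fin.succAbove_succ_self]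
  have h4 : f (Matrix.vecCons (y J.succ) u) = (-1) ^ ((J : ℕ) + 1) * f y := by
    -- In the slot of `u J`, the summand `y J.succ` repeats the front vector and dies. What remains
    -- is `y` with its entry `J + 1` moved to the front.
    have h5 : f (Function.update (Matrix.vecCons (y J.succ) (J.succ.removeNth y)) J.succ
        (y J.succ)) = 0 :=
      f.map_eq_zero_of_eq _ (i := 0) (j := J.succ) (by
        rw [Function.update_self, Function.update_of_ne (Fin.succ_ne_zero J).symm]
        rfl) (Fin.succ_ne_zero J).symm
    rw [h2, f.map_update_add, h5, add_zero, h3, ← f.neg_one_pow_smul_map_insertNth J.succ]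
    simp
  rw [f.map_vecCons_add, f.map_vecCons_smul, f.map_vecCons_smul, eq_neg_of_add_eq_zero_left h0, h4]
  simp only [smul_eq_mul]
  ring

end Transition

theorem sumDet_cast {N k k' d d' : ℕ} (hk : k = k') (hd : d = d') (h : k + d = N)
    (h' : k' + d' = N) (y : Fin k' → Fin N → ℝ) (x : Fin d' → Fin N → ℝ) :
    sumDet h (Sum.elim (fun v => y (Fin.cast hk v)) fun i => x (Fin.cast hd i)) =
      sumDet h' (Sum.elim y x) := by
  subst hk hd
  rfl

theorem cellFunctional_eq_sum_fibreSum {N : ℕ} (t : Surj N) (x : Fin N → ℝ) :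
    cellFunctional t x = ∑ v : Fin t.size, ((v : ℕ) : ℝ) * fibreSum t x v := by
  rw [cellFunctional, coordFunctional_apply, ← Finset.sum_fiberwise Finset.univ t.toFun]
  refine Finset.sum_congr rfl fun v _ => ?_
  rw [fibreSum_apply, Finset.mul_sum]
  refine Finset.sum_congr rfl fun i hi => ?_
  rw [← (Finset.mem_filter.1 hi).2]
  rfl

namespace Surj.Covers

variable {N J : ℕ} {s t : Surj N} (hc : Covers J s t)

include hc

theorem lt_size_left : J < s.size := by have := hc.1; have := hc.2.1; omega

theorem succ_lt_size_left : J + 1 < s.size := by have := hc.1; have := hc.2.1; omega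

theorem toFun_eq_iff (v : Fin t.size) (i : Fin N) :
    t.toFun i = v ↔ s.val i = v ∧ (v : ℕ) ≤ J ∨ s.val i = v + 1 ∧ J ≤ v := by
  have h1 := hc.2.2 i
  have h2 : t.toFun i = v ↔ t.val i = v := Fin.ext_iff
  rw [h2]
  split_ifs at h1 <;> omega

theorem fibreInd_eq (v : Fin t.size) (hv : (v : ℕ) ≠ J) (w : Fin s.size)
    (hw : (w : ℕ) = if (v : ℕ) < J then (v : ℕ) else v + 1) : fibreInd t v = fibreInd s w := by
  funext i
  have h2 : s.toFun i = w ↔ s.val i = w := Fin.ext_iff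
  simp only [fibreInd, hc.toFun_eq_iff, h2]
  refine if_congr ?_ rfl rfl
  split_ifs at hw <;> omega

theorem fibreInd_add : fibreInd t ⟨J, hc.2.1⟩ =
    fibreInd s ⟨J, hc.lt_size_left⟩ + fibreInd s ⟨J + 1, hc.succ_lt_size_left⟩ := by
  funext i
  have h2 : ∀ w, s.toFun i = w ↔ s.val i = w := fun w => Fin.ext_iff
  simp only [fibreInd, hc.toFun_eq_iff, h2, Pi.add_apply]
  split_ifs <;> first | omega | norm_num

theorem fibreSum_eq_zero {x : Fin N → ℝ} (hx : fibreSum t x = 0) (w : Fin s.size)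
    (h1 : (w : ℕ) ≠ J) (h2 : (w : ℕ) ≠ J + 1) : fibreSum s x w = 0 := by
  have hsz := hc.1
  have hw := w.2
  have := hc.2.1
  have h3 := congrFun hx ⟨if (w : ℕ) < J then w else w - 1, by split_ifs <;> omega⟩
  rw [fibreSum_apply, Pi.zero_apply] at h3
  rw [fibreSum_apply, ← h3]
  refine Finset.sum_congr ?_ fun _ _ => rfl
  ext i
  have h4 : s.toFun i = w ↔ s.val i = w := Fin.ext_iff
  simp only [Finset.mem_filter, Finset.mem_univ, true_and, hc.toFun_eq_iff, h4]
  split_ifs <;> omega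

theorem fibreSum_add {x : Fin N → ℝ} (hx : fibreSum t x = 0) :
    fibreSum s x ⟨J, hc.lt_size_left⟩ + fibreSum s x ⟨J + 1, hc.succ_lt_size_left⟩ = 0 := by
  have h3 := congrFun hx ⟨J, hc.2.1⟩
  rw [Pi.zero_apply] at h3
  rw [← h3, fibreSum_apply, fibreSum_apply, fibreSum_apply, Finset.sum_filter, Finset.sum_filter,
    Finset.sum_filter, ← Finset.sum_add_distrib]
  refine Finset.sum_congr rfl fun i _ => ?_
  have h2 : ∀ w, s.toFun i = w ↔ s.val i = w := fun w => Fin.ext_iff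
  simp only [hc.toFun_eq_iff, h2]
  split_ifs <;> first | omega | norm_num

theorem sum_eq_add {M : Type*} [AddCommMonoid M] (F : Fin s.size → M)
    (hF : ∀ w : Fin s.size, (w : ℕ) ≠ J → (w : ℕ) ≠ J + 1 → F w = 0) :
    ∑ w, F w = F ⟨J, hc.lt_size_left⟩ + F ⟨J + 1, hc.succ_lt_size_left⟩ := by
  refine Fintype.sum_eq_add _ _ (fun h => ?_) fun w hw => hF w (fun h => hw.1 (Fin.ext h))
    fun h => hw.2 (Fin.ext h)
  have := congrArg Fin.val h
  simp at this

/-- Only the fibre sums over the two halves survive, and they are opposite, so the weights `J` and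
`J + 1` leave one copy of the second. -/
theorem cellFunctional_eq {x : Fin N → ℝ} (hx : fibreSum t x = 0) :
    cellFunctional s x = fibreSum s x ⟨J + 1, hc.succ_lt_size_left⟩ := by
  rw [cellFunctional_eq_sum_fibreSum, hc.sum_eq_add]
  · have h := hc.fibreSum_add hx
    rw [add_eq_zero_iff_eq_neg] at h
    rw [h]
    push_cast
    ring
  · intro w h1 h2
    rw [hc.fibreSum_eq_zero hx w h1 h2, mul_zero]

/-- The orientation of `s` compared with that of `t`, for an outward vector `w`. -/
theorem sumDet_cons {d : ℕ} (h : t.size + (d + 1) = N) (h' : s.size + d = N)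
    (x : Fin d → Fin N → ℝ)
    (hx : Submodule.span ℝ (Set.range x) = LinearMap.ker (fibreSum s)) (w : Fin N → ℝ)
    (hw : fibreSum t w = 0) (hpos : 0 < cellFunctional s w) :
    ∃ r : ℝ, 0 < r ∧ sumDet h (Sum.elim (fibreInd t) (Fin.cons w x : Fin (d + 1) → Fin N → ℝ)) =
      (-1) ^ (t.size + J + 1) * r * sumDet h' (Sum.elim (fibreInd s) x) := by
  have h'' : t.size + 1 + d = N := by have := hc.1; omega
  set f := (sumDet h'').fixRight x with hf
  set y : Fin (t.size + 1) → Fin N → ℝ := fun v => fibreInd s (Fin.cast hc.1.symm v) with hy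
  set Jt : Fin t.size := ⟨J, hc.2.1⟩ with hJt
  have hfy : f y = sumDet h' (Sum.elim (fibreInd s) x) :=
    sumDet_cast hc.1.symm rfl h'' h' (fibreInd s) x
  -- The mean of `w` over each fibre: subtracting the corresponding combination of indicators puts
  -- `w` in the kernel of `fibreSum s`, which the vectors `x` span and the determinant ignores.
  set γ : Fin s.size → ℝ := fun v => fibreSum s w v / s.type v with hγ
  have htype : ∀ v, (0 : ℝ) < s.type v := fun v => by exact_mod_cast s.hasType_type.pos v
  set α := γ ⟨J, hc.lt_size_left⟩ with hα
  set β := γ ⟨J + 1, hc.succ_lt_size_left⟩ with hβ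
  have hsum : ∑ v, γ v • fibreInd s v = α • y Jt.castSucc + β • y Jt.succ :=
    hc.sum_eq_add _ fun v h1 h2 => by
      simp only [hγ]
      rw [hc.fibreSum_eq_zero hw v h1 h2, zero_div, zero_smul]
  have hg : w - (α • y Jt.castSucc + β • y Jt.succ) ∈ Submodule.span ℝ (Set.range x) := by
    rw [hx, LinearMap.mem_ker, ← hsum, map_sub, sub_eq_zero]
    funext v
    rw [fibreSum_sum_smul_fibreInd, hγ, mul_div_cancel₀ _ (htype v).ne']
  have hzero : ∀ g ∈ Submodule.span ℝ (Set.range x), ∀ u : Fin t.size → Fin N → ℝ,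
      f (Matrix.vecCons g u) = 0 := by
    intro g hg u
    induction hg using Submodule.span_induction with
    | mem g hg =>
      obtain ⟨i, rfl⟩ := hg
      exact (sumDet h'').map_eq_zero_of_eq _ (i := Sum.inl 0) (j := Sum.inr i) rfl Sum.inl_ne_inr
    | zero => exact f.map_coord_zero 0 rfl
    | add a b _ _ ha hb => rw [f.map_vecCons_add, ha, hb, add_zero]
    | smul c a _ ha => rw [f.map_vecCons_smul, ha, smul_zero]
  refine ⟨β - α, ?_, ?_⟩
  · have h1 := hc.fibreSum_add hw
    rw [hc.cellFunctional_eq hw] at hpos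
    have h2 : 0 < β := div_pos hpos (htype _)
    have h3 : α < 0 := div_neg_of_neg_of_pos (by linarith) (htype _)
    linarith
  -- Moving `w` in front of the indicators costs `(-1) ^ t.size`; splitting the indicator of vertex
  -- `J` costs `(-1) ^ (J + 1)`.
  · rw [← sumDet_snoc h'' h]
    change f (Fin.snoc (fibreInd t) w : Fin (t.size + 1) → Fin N → ℝ) = _
    have hw' : w = (α • y Jt.castSucc + β • y Jt.succ) +
        (w - (α • y Jt.castSucc + β • y Jt.succ)) := by abel
    rw [f.map_snoc, hw', f.map_vecCons_add, hzero _ hg, add_zero,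
      f.map_vecCons_split y (fibreInd t) Jt ?_ hc.fibreInd_add, hfy]
    · simp only [hJt, pow_add]
      ring
    · intro v hv
      refine hc.fibreInd_eq v (fun h => hv (Fin.ext h)) _ ?_
      by_cases hlt : (v : ℕ) < J
      · rw [if_pos hlt, Fin.val_cast, Fin.succAbove_of_castSucc_lt]
        · rfl
        · rw [Fin.lt_def]
          change (v : ℕ) < J + 1
          omega
      · rw [if_neg hlt, Fin.val_cast, Fin.succAbove_of_le_castSucc]
        · rfl
        · rw [Fin.le_def]
          change J + 1 ≤ (v : ℕ)
          have : (v : ℕ) ≠ J := fun h => hv (Fin.ext h)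
          omega

end Surj.Covers

/-! ### Incidence numbers and the isomorphism with cellular chains. -/

section

variable {n : ℕ} (o : FaceOrientation (permutohedron n))

/-- The comparison of the orientation of a cell with the one induced by the ordered vertices. -/
def cellSign (t : Surj (n + 1)) : ℤ :=
  SignType.sign (sumDet (size_add_dim t)
    (Sum.elim (fibreInd t) fun i => (o (cellFace t) i : Fin (n + 1) → ℝ)))

theorem cellSign_mul_self (t : Surj (n + 1)) : cellSign o t * cellSign o t = 1 := by
  have h := sumDet_ne_zero (size_add_dim t)
    (linearIndependent_fibreInd_basis (direction_cellFace t) (o (cellFace t)))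
  rw [cellSign]
  rcases lt_or_gt_of_ne h with h | h
  · rw [sign_neg h]; rfl
  · rw [sign_pos h]; rfl

/-- The cell of `s` is the full maximum locus of its functional, so the starting point of the
outward vector, lying off that cell, has a strictly smaller value. -/
theorem cellFunctional_outward_pos {s t : Surj (n + 1)} (h : (cellFace s).IsFacet (cellFace t)) :
    0 < cellFunctional s (h.outward : Fin (n + 1) → ℝ) := by
  have hG : h.outward.1 = (cellFace s).nonempty.some - h.exists_mem_diff.some := rfl
  have h1 := (cellFace s).nonempty.some_mem
  have h2 := h.exists_mem_diff.some_mem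
  rw [hG, map_sub, sub_pos]
  generalize (cellFace s).nonempty.some = x at h1
  generalize h.exists_mem_diff.some = y at h2
  have h3 : x ∈ permutohedronCell s := h1
  have h4 : y ∈ permutohedronCell t := h2.1
  have h5 : y ∉ permutohedronCell s := h2.2
  rw [permutohedronCell_eq_setOf] at h3 h4 h5
  by_contra hle
  exact h5 ⟨h4.1, fun z hz => (h3.2 z hz).trans (not_lt.1 hle)⟩

theorem cellSign_mul_incidence {J : ℕ} {s t : Surj (n + 1)} (hc : Surj.Covers J s t) :
    cellSign o t * incidence o (cellFace t) (cellFace s) =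
      (-1) ^ (t.size + J + 1) * cellSign o s := by
  have hfac : (cellFace s).IsFacet (cellFace t) := cellFace_isFacet_iff.2 ⟨J, hc⟩
  rw [incidence, dif_pos hfac]
  set e := (o (cellFace t)).reindex (finCongr hfac.2) with he
  set z : Fin ((cellFace s).dim + 1) → (cellFace t).direction :=
    Fin.cons hfac.outward fun i => Submodule.inclusion hfac.direction_le (o (cellFace s) i) with hz
  have hd : t.size + ((cellFace s).dim + 1) = n + 1 := by rw [← hfac.2]; exact size_add_dim t
  -- Fixing the indicators of `t` gives a volume form on the direction of its cell, hence `f z = f e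
  -- * e.det z`: the sign of `f e` is `cellSign o t` and that of `e.det z` is the incidence number.
  set f := ((sumDet hd).fixLeft (fibreInd t)).compLinearMap (cellFace t).direction.subtype with hf
  have h1 : f z = f e * e.det z := by
    conv_lhs => rw [AlternatingMap.eq_smul_basis_det e f]
    rfl
  have h2 : f e = sumDet (size_add_dim t)
      (Sum.elim (fibreInd t) fun i => (o (cellFace t) i : Fin (n + 1) → ℝ)) := by
    refine Eq.trans ?_ (sumDet_cast rfl hfac.2.symm hd (size_add_dim t) (fibreInd t)
      fun i => (o (cellFace t) i : Fin (n + 1) → ℝ))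
    change sumDet hd (Sum.elim _ _) = _
    congr 2
    funext i
    simp only [he, Module.Basis.reindex_apply]
    rfl
  have hw : fibreSum t (hfac.outward : Fin (n + 1) → ℝ) = 0 :=
    LinearMap.mem_ker.1 ((direction_cellFace t).le hfac.outward.2)
  obtain ⟨r, hr, h3⟩ := hc.sumDet_cons hd (size_add_dim s)
    (fun i => (o (cellFace s) i : Fin (n + 1) → ℝ))
    (by rw [span_basis_subtype, direction_cellFace]) _ hw (cellFunctional_outward_pos hfac)
  have h4 : f z = sumDet hd (Sum.elim (fibreInd t) (Fin.cons (hfac.outward : Fin (n + 1) → ℝ)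
      fun i => (o (cellFace s) i : Fin (n + 1) → ℝ))) := by
    change sumDet hd (Sum.elim _ _) = _
    congr 2
    funext i
    refine Fin.cases ?_ (fun i => ?_) i <;> rfl
  rw [h3, h1, h2] at h4
  have h5 := congrArg (fun x : ℝ => ((SignType.sign x : SignType) : ℤ)) h4
  simp only [sign_mul, SignType.coe_mul, sign_pos hr, mul_one, sign_pow,
    Left.sign_neg, sign_one, SignType.coe_pow] at h5
  exact h5

theorem incidence_eq_zero {s t : Surj (n + 1)} (h : ∀ J, ¬ Surj.Covers J s t) :
    incidence o (cellFace t) (cellFace s) = 0 := by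
  rw [incidence, dif_neg]
  rw [cellFace_isFacet_iff]
  rintro ⟨J, hJ⟩
  exact h J hJ

/-- A sign depending on the number of vertices only. -/
def sizeSign (k : ℕ) : ℤ := ∏ i ∈ Finset.range k, (-1) ^ (i + 1)

theorem sizeSign_succ (k : ℕ) : sizeSign (k + 1) = sizeSign k * (-1) ^ (k + 1) :=
  Finset.prod_range_succ _ _

theorem sizeSign_mul_self (k : ℕ) : sizeSign k * sizeSign k = 1 := by
  rw [sizeSign, ← Finset.prod_mul_distrib]
  exact Finset.prod_eq_one fun i _ => by rw [← mul_pow]; simp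

/-- The sign of a surjective map in the isomorphism with the cellular chains. -/
def totalSign (t : Surj (n + 1)) : ℤ := t.κ * sizeSign t.size * cellSign o t

theorem totalSign_mul_self (t : Surj (n + 1)) : totalSign o t * totalSign o t = 1 := by
  calc _ = (t.κ * t.κ) * (sizeSign t.size * sizeSign t.size) * (cellSign o t * cellSign o t) := by
        rw [totalSign]; ring
    _ = 1 := by rw [t.κ_mul_self, sizeSign_mul_self, cellSign_mul_self]; rfl

/-- Passing from `k` to `k + 1` vertices changes `sizeSign` by `(-1) ^ (k + 1)`, which reduces the
geometric sign `(-1) ^ (k + J + 1)` to the `(-1) ^ J` of the differential. -/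
theorem totalSign_mul_incidence (s t : Surj (n + 1)) :
    totalSign o t * incidence o (cellFace t) (cellFace s) =
      Surj.bdryCoeff s t * totalSign o s := by
  by_cases h : ∃ J, Surj.Covers J s t
  · obtain ⟨J, hJ⟩ := h
    rw [hJ.bdryCoeff_eq, totalSign, totalSign, mul_assoc, cellSign_mul_incidence o hJ, hJ.1,
      sizeSign_succ]
    calc _ = t.κ * sizeSign t.size * ((-1) ^ (t.size + J + 1) * cellSign o s) * 1 := by ring
      _ = _ := by
        rw [← s.κ_mul_self]
        ring
  · push Not at h
    rw [incidence_eq_zero o h, Surj.bdryCoeff_eq_zero h, mul_zero, zero_mul]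

variable (K : Type u) [CommRing K]

/-- The isomorphism of free modules which is given by a bijection of the bases, with signs. -/
def signedEquiv {X : Type*} {Y : Type*} (e : X ≃ Y) (ε : X → ℤ) (hε : ∀ x, ε x * ε x = 1) :
    (X →₀ K) ≃ₗ[K] (Y →₀ K) :=
  LinearEquiv.ofLinearMap
    (Finsupp.linearCombination K fun x => ε x • Finsupp.single (e x) (1 : K))
    (Finsupp.linearCombination K fun y => ε (e.symm y) • Finsupp.single (e.symm y) (1 : K))
    (by
      refine Finsupp.lhom_ext' fun y => LinearMap.ext_ring ?_
      simp [smul_smul, hε, -Finsupp.smul_single])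
    (by
      refine Finsupp.lhom_ext' fun x => LinearMap.ext_ring ?_
      simp [smul_smul, hε, -Finsupp.smul_single])

theorem signedEquiv_single {X : Type*} {Y : Type*} (e : X ≃ Y) (ε : X → ℤ)
    (hε : ∀ x, ε x * ε x = 1) (x : X) :
    signedEquiv K e ε hε (Finsupp.single x 1) = ε x • Finsupp.single (e x) (1 : K) := by
  change Finsupp.linearCombination K _ _ = _
  rw [Finsupp.linearCombination_single, one_smul]

theorem signedEquiv_mem_supported_iff {X : Type*} {Y : Type*} (e : X ≃ Y) (ε : X → ℤ)
    (hε : ∀ x, ε x * ε x = 1) (A : Set X) (B : Set Y) (hAB : ∀ x, x ∈ A ↔ e x ∈ B) (f : X →₀ K) :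
    f ∈ Finsupp.supported K K A ↔ signedEquiv K e ε hε f ∈ Finsupp.supported K K B := by
  constructor
  · intro hf
    change Finsupp.linearCombination K _ f ∈ _
    rw [Finsupp.linearCombination_apply]
    exact Submodule.sum_mem _ fun x hx => Submodule.smul_mem _ _ (zsmul_mem
      (Finsupp.single_mem_supported K _ ((hAB x).1 (hf hx))) _)
  · intro hf
    rw [← (signedEquiv K e ε hε).symm_apply_apply f]
    generalize signedEquiv K e ε hε f = g at hf
    change Finsupp.linearCombination K _ g ∈ _
    rw [Finsupp.linearCombination_apply]
    exact Submodule.sum_mem _ fun y hy => Submodule.smul_mem _ _ (zsmul_mem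
      (Finsupp.single_mem_supported K _ ((hAB _).2 (by rw [e.apply_symm_apply]; exact hf hy))) _)

/-- The isomorphism of `permAs_∞` with the cellular chains of the permutohedron. -/
def permCellEquiv : (Surj (n + 1) →₀ K) ≃ₗ[K] (Face (permutohedron n) →₀ K) :=
  signedEquiv K (cellEquiv n) (totalSign o) (totalSign_mul_self o)

theorem cellularBoundary_single (t : Surj (n + 1)) :
    cellularBoundary K o (Finsupp.single (cellFace t) 1) =
      ∑ s, incidence o (cellFace t) (cellFace s) • Finsupp.single (cellFace s) (1 : K) := by
  have : Fintype (Face (permutohedron n)) := Fintype.ofEquiv _ (cellEquiv n)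
  rw [cellularBoundary, Finsupp.linearCombination_single, one_smul, finsum_eq_sum_of_fintype,
    ← (cellEquiv n).sum_comp]
  rfl

theorem permCellEquiv_permBdry (x : Surj (n + 1) →₀ K) :
    permCellEquiv o K (permBdry K (n + 1) x) = cellularBoundary K o (permCellEquiv o K x) := by
  suffices h : (permCellEquiv o K : _ →ₗ[K] _) ∘ₗ permBdry K (n + 1) =
      cellularBoundary K o ∘ₗ (permCellEquiv o K : _ →ₗ[K] _) from LinearMap.congr_fun h x
  refine Finsupp.lhom_ext' fun t => LinearMap.ext_ring ?_
  have h1 : ∀ s, permCellEquiv o K (Finsupp.single s 1) =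
      totalSign o s • Finsupp.single (cellFace s) (1 : K) := fun s => signedEquiv_single K _ _ _ s
  simp only [LinearMap.comp_apply, Finsupp.lsingle_apply, LinearEquiv.coe_coe]
  rw [permBdry_single, map_sum, h1, map_zsmul, cellularBoundary_single, Finset.smul_sum]
  refine Finset.sum_congr rfl fun s _ => ?_
  rw [map_zsmul, h1, smul_smul, smul_smul, totalSign_mul_incidence]

/-- No geometry of codimension-two faces is needed: the identity is transported from
`permBdry_permBdry` along the isomorphism. -/
theorem cellularBoundary_comp_self :
    cellularBoundary K o ∘ₗ cellularBoundary K o = 0 := by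
  refine LinearMap.ext fun y => ?_
  obtain ⟨x, rfl⟩ := (permCellEquiv o K).surjective y
  rw [LinearMap.comp_apply, ← permCellEquiv_permBdry, ← permCellEquiv_permBdry,
    permBdry_permBdry, map_zero, LinearMap.zero_apply]

theorem mem_surjDeg_iff (i : ℤ) (x : Surj (n + 1) →₀ K) :
    x ∈ surjDeg K (n + 1) i ↔ permCellEquiv o K x ∈ cellularChains K (permutohedron n) i := by
  refine signedEquiv_mem_supported_iff K _ _ _ _ _ (fun t => ?_) x
  have h := size_add_dim t
  change ((n + 1 : ℕ) : ℤ) - t.size = i ↔ ((cellFace t).dim : ℤ) = i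
  omega

theorem permCellEquiv_single (t : Surj (n + 1)) :
    permCellEquiv o K (Finsupp.single t 1) = Finsupp.single (cellFace t) 1 ∨
      permCellEquiv o K (Finsupp.single t 1) = -Finsupp.single (cellFace t) 1 := by
  have h : permCellEquiv o K (Finsupp.single t 1) =
    totalSign o t • Finsupp.single (cellFace t) (1 : K) := signedEquiv_single K _ _ _ t
  rw [h]
  rcases mul_self_eq_one_iff.1 (totalSign_mul_self o t) with h | h
  · exact Or.inl (by rw [h, one_smul])
  · exact Or.inr (by rw [h, neg_one_smul])

end

end

theorem mainTheorem3 (K : Type u) [CommRing K] :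
    -- the underlying graded permutad of `permAs_∞` is free on the generators `m_{n+2}`,
    -- which have arity `n + 2` and homological degree `n`
    GradedPermutad.IsFreeOn.{u, u, w, 0} (permAsInf K) (fun n : ℕ => n + 1) (fun n => (n : ℤ))
      (gen K) ∧
    -- the boundary of the big cells extends uniquely to a derivation of `permAs_∞`
    ∃ d : ∀ n, (permAsInf K).op n →ₗ[K] (permAsInf K).op n,
      ((permAsInf K).IsDerivation d ∧ ∀ n, d (n + 1) (gen K n) = bigCellBoundary K n) ∧
      (∀ d' : ∀ n, (permAsInf K).op n →ₗ[K] (permAsInf K).op n,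
        (permAsInf K).IsDerivation d' → (∀ n, d' (n + 1) (gen K n) = bigCellBoundary K n) →
          d' = d) ∧
      -- with this derivation, `permAs_∞` is a dg permutad
      (permAsInf K).IsDG d ∧
      -- in arity `n + 2` it is isomorphic to the cellular chain complex of the permutohedron `P^n`,
      -- in such a way that surjective maps correspond to oriented cells
      ∀ (n : ℕ) (o : FaceOrientation (permutohedron n)),
        cellularBoundary K o ∘ₗ cellularBoundary K o = 0 ∧
        ∃ Φ : (permAsInf K).op (n + 1) ≃ₗ[K] (Face (permutohedron n) →₀ K),
          (∀ (i : ℤ) (x : (permAsInf K).op (n + 1)),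
            x ∈ (permAsInf K).deg (n + 1) i ↔ Φ x ∈ cellularChains K (permutohedron n) i) ∧
          (∀ x : (permAsInf K).op (n + 1), Φ (d (n + 1) x) = cellularBoundary K o (Φ x)) ∧
          (∀ t : Surj (n + 1), ∃ F : Face (permutohedron n), F.carrier = permutohedronCell t ∧
            (Φ (Finsupp.single t 1 : Surj (n + 1) →₀ K) = Finsupp.single F 1 ∨
              Φ (Finsupp.single t 1 : Surj (n + 1) →₀ K) = -Finsupp.single F 1)) := by
  refine ⟨isFreeOn_permAsInf K, permBdry K, ⟨isDerivation_permBdry K, permBdry_corolla K⟩,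
    fun d' hd' hg => ?_, ⟨isDerivation_permBdry K, permBdry_permBdry K⟩, fun n o => ?_⟩
  · exact isDerivation_unique K hd' (isDerivation_permBdry K) fun n =>
      (hg n).trans (permBdry_corolla K n).symm
  · exact ⟨cellularBoundary_comp_self o K, permCellEquiv o K, mem_surjDeg_iff o K,
      permCellEquiv_permBdry o K, fun t => ⟨cellFace t, rfl, permCellEquiv_single o K t⟩⟩
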